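/- Let $A$ be a finite alphabet with $k$ letters. Formulas of $\mathrm{FO}^2[<]$ over $A$ are first-order formulas using only two variables (which may be requantified), built from the truth constants and the atomic formulas $x<y$, $x=y$ and $a(x)$ for $a\in A$ by Boolean connectives and quantifiers. They are interpreted in finite words over $A$ (including the empty word): variables range over the positions of the word, $<$ is the order of positions, and $a(x)$ says that the letter at position $x$ is $a$. A sentence defines the language of all words in $A^*$ in which it is true. The number of quantifier blocks of a formula is obtained by first pushing all negations down to the atomic formulas and then taking the largest number of maximal runs of quantifiers of the same kind ($\exists$ or $\forall$) met on a path from the root of the parse tree to a leaf. Then every language $L\subseteq A^*$ that is definable by an $\mathrm{FO}^2[<]$ sentence is definable by an $\mathrm{FO}^2[<]$ sentence whose number of quantifier blocks is $k$. In particular, the alternation hierarchy over $A$ collapses at level $k$: for every $m\ge k$, the languages over $A$ definable by $\mathrm{FO}^2[<]$ sentences with at most $m$ quantifier blocks are exactly those definable by $\mathrm{FO}^2[<]$ sentences with at most $k$ quantifier blocks. -/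

import Mathlib

/-- Formulas of `FO²[<]` over the alphabet `A`: first-order formulas over the order on the positions
of a word, equality of positions, and one unary predicate for each letter, in which only the two
variables `0` and `1` occur. The variables may be requantified. -/
inductive FO2Formula (A : Type*) where
  | falsum : FO2Formula A
  | lt (x y : Fin 2) : FO2Formula A
  | eq (x y : Fin 2) : FO2Formula A
  | letter (a : A) (x : Fin 2) : FO2Formula A
  | neg (φ : FO2Formula A) : FO2Formula A
  | and (φ ψ : FO2Formula A) : FO2Formula A
  | or (φ ψ : FO2Formula A) : FO2Formula A
  | ex (x : Fin 2) (φ : FO2Formula A) : FO2Formula A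
  | all (x : Fin 2) (φ : FO2Formula A) : FO2Formula A

namespace FO2Formula

variable {A : Type*}

/-- The variables that occur freely. -/
def freeVars : FO2Formula A → Finset (Fin 2)
  | falsum => ∅
  | lt x y => {x, y}
  | eq x y => {x, y}
  | letter _ x => {x}
  | neg φ => φ.freeVars
  | and φ ψ => φ.freeVars ∪ ψ.freeVars
  | or φ ψ => φ.freeVars ∪ ψ.freeVars
  | ex x φ => φ.freeVars.erase x
  | all x φ => φ.freeVars.erase x

/-- A sentence is a formula without free variables. -/
def IsSentence (φ : FO2Formula A) : Prop := φ.freeVars = ∅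

/-- `φ.Sat w v`: the formula `φ` holds in the word `w` when the variable `x` denotes the
position `v x`. The positions of `w` are the natural numbers `i < w.length`, and the quantifiers
range over these. -/
def Sat (w : List A) : FO2Formula A → (Fin 2 → ℕ) → Prop
  | falsum, _ => False
  | lt x y, v => v x < v y
  | eq x y, v => v x = v y
  | letter a x, v => w[v x]? = some a
  | neg φ, v => ¬ φ.Sat w v
  | and φ ψ, v => φ.Sat w v ∧ ψ.Sat w v
  | or φ ψ, v => φ.Sat w v ∨ ψ.Sat w v
  | ex x φ, v => ∃ i < w.length, φ.Sat w (Function.update v x i)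
  | all x φ, v => ∀ i < w.length, φ.Sat w (Function.update v x i)

/-- Satisfaction depends only on the values of the free variables. -/
theorem sat_congr (w : List A) (φ : FO2Formula A) :
    ∀ v v' : Fin 2 → ℕ, (∀ x ∈ φ.freeVars, v x = v' x) → (φ.Sat w v ↔ φ.Sat w v') := by
  have upd : ∀ (x : Fin 2) (φ : FO2Formula A) (v v' : Fin 2 → ℕ) (i : ℕ),
      (∀ y ∈ φ.freeVars.erase x, v y = v' y) →
      ∀ y ∈ φ.freeVars, Function.update v x i y = Function.update v' x i y := by
    intro x φ v v' i h y hy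
    by_cases hyx : y = x
    · subst hyx; simp
    · simp [Function.update_of_ne hyx, h y (Finset.mem_erase.2 ⟨hyx, hy⟩)]
  induction φ with
  | falsum => intro v v' _; rfl
  | lt x y => intro v v' h; simp [Sat, h x (by simp [freeVars]), h y (by simp [freeVars])]
  | eq x y => intro v v' h; simp [Sat, h x (by simp [freeVars]), h y (by simp [freeVars])]
  | letter a x => intro v v' h; simp [Sat, h x (by simp [freeVars])]
  | neg φ ih => intro v v' h; exact not_congr (ih v v' h)
  | and φ ψ ih₁ ih₂ =>
    intro v v' h
    exact and_congr (ih₁ v v' fun x hx => h x (Finset.mem_union_left _ hx))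
      (ih₂ v v' fun x hx => h x (Finset.mem_union_right _ hx))
  | or φ ψ ih₁ ih₂ =>
    intro v v' h
    exact or_congr (ih₁ v v' fun x hx => h x (Finset.mem_union_left _ hx))
      (ih₂ v v' fun x hx => h x (Finset.mem_union_right _ hx))
  | ex x φ ih =>
    intro v v' h
    exact exists_congr fun i => and_congr_right fun _ => ih _ _ (upd x φ v v' i h)
  | all x φ ih =>
    intro v v' h
    exact forall_congr' fun i => imp_congr_right fun _ => ih _ _ (upd x φ v v' i h)

/-- The truth of a sentence in a word does not depend on the assignment. -/
theorem IsSentence.sat_iff {φ : FO2Formula A} (h : φ.IsSentence) (w : List A) (v v' : Fin 2 → ℕ) :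
    φ.Sat w v ↔ φ.Sat w v' :=
  sat_congr w φ v v' fun x hx => by simp [IsSentence.eq_1 φ ▸ h] at hx

/-- The language defined by a sentence: all words, the empty one included, in which it is true.
(For a sentence the assignment used here is irrelevant.) -/
def language (φ : FO2Formula A) : Language A :=
  {w : List A | φ.Sat w fun _ => 0}

/-- The largest number of quantifier blocks that begin on a path from the root of `φ` to a leaf, in
the negation normal form of `φ` (if `pos = true`) or of `¬ φ` (if `pos = false`). Here `cur` is the
kind of the quantifier above `φ` that is nearest to it (`some true` for `∃`, `some false` for `∀`,
`none` if there is none); a quantifier begins a new block unless its kind in the negation normal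
form is `cur`. -/
def blocksFrom : FO2Formula A → (pos : Bool) → (cur : Option Bool) → ℕ
  | falsum, _, _ => 0
  | lt _ _, _, _ => 0
  | eq _ _, _, _ => 0
  | letter _ _, _, _ => 0
  | neg φ, pos, cur => φ.blocksFrom (!pos) cur
  | and φ ψ, pos, cur => max (φ.blocksFrom pos cur) (ψ.blocksFrom pos cur)
  | or φ ψ, pos, cur => max (φ.blocksFrom pos cur) (ψ.blocksFrom pos cur)
  | ex _ φ, pos, cur => (if cur = some pos then 0 else 1) + φ.blocksFrom pos (some pos)
  | all _ φ, pos, cur => (if cur = some (!pos) then 0 else 1) + φ.blocksFrom pos (some (!pos))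

/-- The number of quantifier blocks of a formula: after all negations have been pushed down to the
atomic formulas, the largest number of maximal runs of equal quantifiers (all `∃` or all `∀`) on a
path from the root of the parse tree to a leaf. -/
def blocks (φ : FO2Formula A) : ℕ := φ.blocksFrom true none

end FO2Formula

/-- The language `L` is definable by a sentence of `FO²[<]`. -/
def FO2Definable {A : Type*} (L : Language A) : Prop :=
  ∃ φ : FO2Formula A, φ.IsSentence ∧ φ.language = L

/-- Level `m` of the alternation hierarchy: the languages over `A` that are definable by a sentence
of `FO²[<]` with at most `m` quantifier blocks. -/
def FO2Level (A : Type*) (m : ℕ) : Set (Language A) :=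
  {L | ∃ φ : FO2Formula A, φ.IsSentence ∧ φ.blocks ≤ m ∧ φ.language = L}

/-! A sentence of quantifier depth `n` cannot separate words related by `WordEquiv n`, the `n`-round
two-pebble game, and this equivalence is a congruence of finite index with definable classes. Hence
it suffices to find, over an alphabet `B` of `k + 1` letters, finitely many sentences with at most
`k + 1` blocks whose truth values determine the game class of a word over `B`; the language is then
a Boolean combination of them. This is done by induction on the size of `B`; over the empty alphabet
there is only the empty word.

Cut a word at the first occurrence of a letter `c`. The prefix omits `c`, so by induction `k` blocks
suffice to describe its class. The cut is located by a purely existential formula, and relativizing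
to the prefix costs only one further block (`blocksFrom_relativize`, `gap_preimage_mem_levelOver`).
Repeating this in the rest, for all letter sequences of bounded length, gives `GreedyEquiv`; the
mirrored sentences do the same from the right.

These data suffice. If a letter is missing from the rest, the rest itself is compared completely.
Otherwise, cutting at the letter that appears last splits off a factor containing all of `B`. So
either the words are already known to be equivalent, or they have equivalent prefixes, and likewise
equivalent suffixes, with many such full factors. Between them the middle is invisible in `n`
rounds, because every letter is available on either side (`wordEquiv_of_isFull`), so only prefix and
suffix matter (`GreedyEquiv.wordEquiv`). -/

/-! ### Separation by finitely many members of a Boolean family -/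

section Separation

variable {X : Type*}

/-- `𝒟` is closed under Boolean operations, and under changes outside `W`. -/
structure IsBooleanOn (W : Set X) (𝒟 : Set (Set X)) : Prop where
  univ_mem : Set.univ ∈ 𝒟
  compl_mem : ∀ M ∈ 𝒟, Mᶜ ∈ 𝒟
  inter_mem : ∀ M ∈ 𝒟, ∀ N ∈ 𝒟, M ∩ N ∈ 𝒟
  congr_mem : ∀ M ∈ 𝒟, ∀ N, (∀ x ∈ W, x ∈ M ↔ x ∈ N) → N ∈ 𝒟

/-- The points of `W` that lie in the same members of a suitable finite part of `𝒟` are related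
by `E`. -/
def FinitelySeparated (W : Set X) (𝒟 : Set (Set X)) (E : X → X → Prop) : Prop :=
  ∃ S : Set (Set X), S.Finite ∧ S ⊆ 𝒟 ∧
    ∀ u ∈ W, ∀ v ∈ W, (∀ M ∈ S, u ∈ M ↔ v ∈ M) → E u v

variable {W : Set X} {𝒟 : Set (Set X)}

/-- Induction on `S`: a new member `N` splits `L` into its parts inside and outside `N`, each of
which is cut out by a set saturated for the smaller family. With no members left, `L` is empty or
everything on `W`. -/
theorem IsBooleanOn.mem_of_saturated (h : IsBooleanOn W 𝒟) {S : Set (Set X)} (hS : S.Finite)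
    (hSD : S ⊆ 𝒟) (L : Set X)
    (hL : ∀ u ∈ W, ∀ v ∈ W, (∀ M ∈ S, u ∈ M ↔ v ∈ M) → u ∈ L → v ∈ L) : L ∈ 𝒟 := by
  induction S, hS using Set.Finite.induction_on generalizing L with
  | empty =>
    by_cases hne : ∃ u ∈ W, u ∈ L
    · obtain ⟨u, hu, huL⟩ := hne
      exact h.congr_mem _ h.univ_mem _ fun v hv => by
        simpa using hL u hu v hv (by simp) huL
    · push Not at hne
      exact h.congr_mem _ (h.compl_mem _ h.univ_mem) _ fun v hv => by simpa using hne v hv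
  | @insert N S _ _ ih =>
    have hN : N ∈ 𝒟 := hSD (Set.mem_insert _ _)
    have hS' : S ⊆ 𝒟 := fun M hM => hSD (Set.mem_insert_of_mem _ hM)
    -- The saturation under `S` of the part of `L` in `P`; it is needed for `P = N` and `P = Nᶜ`.
    have key : ∀ P : Set X, {u | ∃ v ∈ W, v ∈ P ∧ v ∈ L ∧ ∀ M ∈ S, v ∈ M ↔ u ∈ M} ∈ 𝒟 := by
      intro P
      refine ih hS' _ ?_
      rintro u hu v hv huv ⟨t, ht, htP, htL, htu⟩
      exact ⟨t, ht, htP, htL, fun M hM => (htu M hM).trans (huv M hM)⟩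
    have h1 := h.inter_mem _ hN _ (key N)
    have h2 := h.inter_mem _ (h.compl_mem _ hN) _ (key Nᶜ)
    refine h.congr_mem _ (h.compl_mem _ (h.inter_mem _ (h.compl_mem _ h1) _ (h.compl_mem _ h2)))
      _ ?_
    intro x hx
    simp only [Set.mem_compl_iff, Set.mem_inter_iff, Set.mem_ofPred_eq]
    constructor
    · intro hx'
      rcases not_and_or.1 hx' with hx' | hx' <;>
      · obtain ⟨hxN, v, hv, hvN, hvL, hvx⟩ := not_not.1 hx'
        refine hL v hv x hx ?_ hvL
        rintro M (rfl | hM)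
        · first | exact iff_of_true hvN hxN | exact iff_of_false hvN hxN
        · exact hvx M hM
    · intro hxL
      by_cases hxN : x ∈ N
      · exact fun hc => hc.1 ⟨hxN, x, hx, hxN, hxL, fun _ _ => Iff.rfl⟩
      · exact fun hc => hc.2 ⟨hxN, x, hx, hxN, hxL, fun _ _ => Iff.rfl⟩

theorem FinitelySeparated.mem_of_saturated {E : X → X → Prop} (hE : FinitelySeparated W 𝒟 E)
    (h : IsBooleanOn W 𝒟) (L : Set X)
    (hL : ∀ u ∈ W, ∀ v ∈ W, E u v → u ∈ L → v ∈ L) : L ∈ 𝒟 := by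
  obtain ⟨S, hS, hSD, hSE⟩ := hE
  exact h.mem_of_saturated hS hSD L fun u hu v hv huv => hL u hu v hv (hSE u hu v hv huv)

theorem FinitelySeparated.mono {E E' : X → X → Prop} (hE : FinitelySeparated W 𝒟 E)
    (h : ∀ u ∈ W, ∀ v ∈ W, E u v → E' u v) : FinitelySeparated W 𝒟 E' := by
  obtain ⟨S, hS, hSD, hSE⟩ := hE
  exact ⟨S, hS, hSD, fun u hu v hv huv => h u hu v hv (hSE u hu v hv huv)⟩

theorem FinitelySeparated.and {E E' : X → X → Prop} (hE : FinitelySeparated W 𝒟 E)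
    (hE' : FinitelySeparated W 𝒟 E') : FinitelySeparated W 𝒟 (fun u v => E u v ∧ E' u v) := by
  obtain ⟨S, hS, hSD, hSE⟩ := hE
  obtain ⟨T, hT, hTD, hTE⟩ := hE'
  exact ⟨S ∪ T, hS.union hT, Set.union_subset hSD hTD, fun u hu v hv huv =>
    ⟨hSE u hu v hv fun M hM => huv M (Or.inl hM), hTE u hu v hv fun M hM => huv M (Or.inr hM)⟩⟩

theorem FinitelySeparated.forall {ι : Type*} [Finite ι] {E : ι → X → X → Prop}
    (hE : ∀ i, FinitelySeparated W 𝒟 (E i)) :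
    FinitelySeparated W 𝒟 (fun u v => ∀ i, E i u v) := by
  choose S hS hSD hSE using hE
  exact ⟨⋃ i, S i, Set.finite_iUnion hS, Set.iUnion_subset hSD, fun u hu v hv huv i =>
    hSE i u hu v hv fun M hM => huv M (Set.mem_iUnion_of_mem i hM)⟩

theorem finitelySeparated_of_mem {M : Set X} (hM : M ∈ 𝒟) :
    FinitelySeparated W 𝒟 (fun u v => u ∈ M ↔ v ∈ M) :=
  ⟨{M}, Set.finite_singleton _, by simpa, fun _ _ _ _ h => h M rfl⟩

theorem FinitelySeparated.comap {Y : Type*} {V : Set Y} {𝒞 : Set (Set Y)} {E : X → X → Prop}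
    (hE : FinitelySeparated W 𝒟 E) (f : Y → X) (hf : ∀ y ∈ V, f y ∈ W)
    (h : ∀ M ∈ 𝒟, f ⁻¹' M ∈ 𝒞) : FinitelySeparated V 𝒞 (fun u v => E (f u) (f v)) := by
  obtain ⟨S, hS, hSD, hSE⟩ := hE
  refine ⟨Set.preimage f '' S, hS.image _, ?_, fun u hu v hv huv => ?_⟩
  · rintro _ ⟨M, hM, rfl⟩
    exact h M (hSD hM)
  · exact hSE _ (hf u hu) _ (hf v hv) fun M hM => huv _ ⟨M, hM, rfl⟩

end Separation

/-! ### The two-pebble game -/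

/-- `p'` lies on the same side of `p` as `q'` of `q`. -/
def SameSide (p p' q q' : ℕ) : Prop := (p' < p ↔ q' < q) ∧ (p < p' ↔ q < q')

/-- Back-and-forth equivalence of depth `n` of the position `p` of `u` and the position `q`
of `v`. -/
def BackForth {A : Type*} : ℕ → List A → ℕ → List A → ℕ → Prop
  | 0, u, p, v, q => u[p]? = v[q]?
  | n + 1, u, p, v, q => u[p]? = v[q]? ∧
      (∀ p' < u.length, ∃ q' < v.length, SameSide p p' q q' ∧ BackForth n u p' v q') ∧
      (∀ q' < v.length, ∃ p' < u.length, SameSide p p' q q' ∧ BackForth n u p' v q')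

/-- Back-and-forth equivalence of depth `n` of words. -/
def WordEquiv {A : Type*} (n : ℕ) (u v : List A) : Prop :=
  (∀ p < u.length, ∃ q < v.length, BackForth n u p v q) ∧
    (∀ q < v.length, ∃ p < u.length, BackForth n u p v q)

section Game

variable {A : Type*}

theorem SameSide.symm {p p' q q' : ℕ} (h : SameSide p p' q q') : SameSide q q' p p' :=
  ⟨h.1.symm, h.2.symm⟩

namespace BackForth

theorem letter {n : ℕ} {u v : List A} {p q : ℕ} (h : BackForth n u p v q) : u[p]? = v[q]? := by
  cases n with
  | zero => exact h
  | succ n => exact h.1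

theorem pred {n : ℕ} {u v : List A} {p q : ℕ} (h : BackForth (n + 1) u p v q) :
    BackForth n u p v q := by
  induction n generalizing p q with
  | zero => exact h.1
  | succ n ih =>
    refine ⟨h.1, fun p' hp' => ?_, fun q' hq' => ?_⟩
    · obtain ⟨q', hq', hs, hb⟩ := h.2.1 p' hp'
      exact ⟨q', hq', hs, ih hb⟩
    · obtain ⟨p', hp', hs, hb⟩ := h.2.2 q' hq'
      exact ⟨p', hp', hs, ih hb⟩

theorem refl (n : ℕ) (u : List A) (p : ℕ) : BackForth n u p u p := by
  induction n generalizing p with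
  | zero => rfl
  | succ n ih =>
    exact ⟨rfl, fun p' hp' => ⟨p', hp', ⟨Iff.rfl, Iff.rfl⟩, ih p'⟩,
      fun p' hp' => ⟨p', hp', ⟨Iff.rfl, Iff.rfl⟩, ih p'⟩⟩

theorem symm {n : ℕ} {u v : List A} {p q : ℕ} (h : BackForth n u p v q) :
    BackForth n v q u p := by
  induction n generalizing p q with
  | zero => exact Eq.symm h
  | succ n ih =>
    refine ⟨h.1.symm, fun q' hq' => ?_, fun p' hp' => ?_⟩
    · obtain ⟨p', hp', hs, hb⟩ := h.2.2 q' hq'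
      exact ⟨p', hp', hs.symm, ih hb⟩
    · obtain ⟨q', hq', hs, hb⟩ := h.2.1 p' hp'
      exact ⟨q', hq', hs.symm, ih hb⟩

theorem trans {n : ℕ} {u v w : List A} {p q r : ℕ} (h : BackForth n u p v q)
    (h' : BackForth n v q w r) : BackForth n u p w r := by
  induction n generalizing p q r with
  | zero => exact Eq.trans h h'
  | succ n ih =>
    refine ⟨h.1.trans h'.1, fun p' hp' => ?_, fun r' hr' => ?_⟩
    · obtain ⟨q', hq', hs, hb⟩ := h.2.1 p' hp'
      obtain ⟨r', hr', hs', hb'⟩ := h'.2.1 q' hq'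
      exact ⟨r', hr', ⟨hs.1.trans hs'.1, hs.2.trans hs'.2⟩, ih hb hb'⟩
    · obtain ⟨q', hq', hs', hb'⟩ := h'.2.2 r' hr'
      obtain ⟨p', hp', hs, hb⟩ := h.2.2 q' hq'
      exact ⟨p', hp', ⟨hs.1.trans hs'.1, hs.2.trans hs'.2⟩, ih hb hb'⟩

/-- A family of relations that respects letters and has the back and forth properties for `n`
rounds implies back-and-forth equivalence. -/
theorem of_bisim {u v : List A} {Z : ℕ → ℕ → ℕ → Prop} {n : ℕ}
    (hl : ∀ m p q, Z m p q → u[p]? = v[q]?)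
    (hf : ∀ m p q, m < n → Z (m + 1) p q →
      ∀ p' < u.length, ∃ q' < v.length, SameSide p p' q q' ∧ Z m p' q')
    (hb : ∀ m p q, m < n → Z (m + 1) p q →
      ∀ q' < v.length, ∃ p' < u.length, SameSide p p' q q' ∧ Z m p' q')
    {m p q : ℕ} (hm : m ≤ n) (h : Z m p q) : BackForth m u p v q := by
  induction m generalizing p q with
  | zero => exact hl _ _ _ h
  | succ m ih =>
    refine ⟨hl _ _ _ h, fun p' hp' => ?_, fun q' hq' => ?_⟩
    · obtain ⟨q', hq', hs, hz⟩ := hf m p q hm h p' hp'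
      exact ⟨q', hq', hs, ih (by omega) hz⟩
    · obtain ⟨p', hp', hs, hz⟩ := hb m p q hm h q' hq'
      exact ⟨p', hp', hs, ih (by omega) hz⟩

theorem reverse {n : ℕ} {u v : List A} {p q : ℕ} (hp : p < u.length) (hq : q < v.length)
    (h : BackForth n u p v q) :
    BackForth n u.reverse (u.length - 1 - p) v.reverse (v.length - 1 - q) := by
  refine of_bisim (n := n) (Z := fun m p q => p < u.length ∧ q < v.length ∧
    BackForth m u (u.length - 1 - p) v (v.length - 1 - q)) ?_ ?_ ?_ le_rfl
    ⟨by omega, by omega, ?_⟩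
  · rintro m p q ⟨hp, hq, h⟩
    rw [List.getElem?_reverse hp, List.getElem?_reverse hq]
    exact h.letter
  · rintro m p q - ⟨hp, hq, h⟩ p' hp'
    rw [List.length_reverse] at hp'
    obtain ⟨q', hq', hs, hb⟩ := h.2.1 (u.length - 1 - p') (by omega)
    refine ⟨v.length - 1 - q', by rw [List.length_reverse]; omega, ?_, hp', by omega, ?_⟩
    · unfold SameSide at *; omega
    · rwa [show v.length - 1 - (v.length - 1 - q') = q' by omega]
  · rintro m p q - ⟨hp, hq, h⟩ q' hq'
    rw [List.length_reverse] at hq'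
    obtain ⟨p', hp', hs, hb⟩ := h.2.2 (v.length - 1 - q') (by omega)
    refine ⟨u.length - 1 - p', by rw [List.length_reverse]; omega, ?_, by omega, hq', ?_⟩
    · unfold SameSide at *; omega
    · rwa [show u.length - 1 - (u.length - 1 - p') = p' by omega]
  · rwa [show u.length - 1 - (u.length - 1 - p) = p by omega,
      show v.length - 1 - (v.length - 1 - q) = q by omega]

end BackForth

namespace WordEquiv

theorem refl (n : ℕ) (u : List A) : WordEquiv n u u :=
  ⟨fun p hp => ⟨p, hp, .refl n u p⟩, fun p hp => ⟨p, hp, .refl n u p⟩⟩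

theorem symm {n : ℕ} {u v : List A} (h : WordEquiv n u v) : WordEquiv n v u := by
  refine ⟨fun p hp => ?_, fun q hq => ?_⟩
  · obtain ⟨q, hq, hb⟩ := h.2 p hp
    exact ⟨q, hq, hb.symm⟩
  · obtain ⟨p, hp, hb⟩ := h.1 q hq
    exact ⟨p, hp, hb.symm⟩

theorem trans {n : ℕ} {u v w : List A} (h : WordEquiv n u v) (h' : WordEquiv n v w) :
    WordEquiv n u w := by
  refine ⟨fun p hp => ?_, fun r hr => ?_⟩
  · obtain ⟨q, hq, hb⟩ := h.1 p hp
    obtain ⟨r, hr, hb'⟩ := h'.1 q hq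
    exact ⟨r, hr, hb.trans hb'⟩
  · obtain ⟨q, hq, hb'⟩ := h'.2 r hr
    obtain ⟨p, hp, hb⟩ := h.2 q hq
    exact ⟨p, hp, hb.trans hb'⟩

theorem pred {n : ℕ} {u v : List A} (h : WordEquiv (n + 1) u v) : WordEquiv n u v := by
  refine ⟨fun p hp => ?_, fun q hq => ?_⟩
  · obtain ⟨q, hq, hb⟩ := h.1 p hp
    exact ⟨q, hq, hb.pred⟩
  · obtain ⟨p, hp, hb⟩ := h.2 q hq
    exact ⟨p, hp, hb.pred⟩

theorem mem {n : ℕ} {u v : List A} (h : WordEquiv n u v) {a : A} (ha : a ∈ u) : a ∈ v := by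
  obtain ⟨p, hp, rfl⟩ := List.mem_iff_getElem.1 ha
  obtain ⟨q, hq, hb⟩ := h.1 p hp
  have := hb.letter
  rw [List.getElem?_eq_getElem hp] at this
  exact List.mem_of_getElem? this.symm

theorem reverse {n : ℕ} {u v : List A} (h : WordEquiv n u v) :
    WordEquiv n u.reverse v.reverse := by
  refine ⟨fun p hp => ?_, fun q hq => ?_⟩
  · rw [List.length_reverse] at hp
    obtain ⟨q, hq, hb⟩ := h.1 (u.length - 1 - p) (by omega)
    have := hb.reverse (by omega) hq
    rw [show u.length - 1 - (u.length - 1 - p) = p by omega] at this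
    exact ⟨_, by rw [List.length_reverse]; omega, this⟩
  · rw [List.length_reverse] at hq
    obtain ⟨p, hp, hb⟩ := h.2 (v.length - 1 - q) (by omega)
    have := hb.reverse hp (by omega)
    rw [show v.length - 1 - (v.length - 1 - q) = q by omega] at this
    exact ⟨_, by rw [List.length_reverse]; omega, this⟩

/-- A move within the current factor is answered by the local strategy there. A move into the other
factor is answered afresh from the equivalence of those factors, and its side is automatically
right. -/
theorem append_forth {n : ℕ} {u u' v v' : List A} {Z : ℕ → ℕ → ℕ → Prop}
    (hZ : Z = fun m p q => WordEquiv m u v ∧ WordEquiv m u' v' ∧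
      ((p < u.length ∧ q < v.length ∧ BackForth m u p v q) ∨
        (u.length ≤ p ∧ v.length ≤ q ∧ BackForth m u' (p - u.length) v' (q - v.length))))
    {p q : ℕ} (h : Z (n + 1) p q) (p' : ℕ) (hp' : p' < (u ++ u').length) :
    ∃ q' < (v ++ v').length, SameSide p p' q q' ∧ Z n p' q' := by
  subst hZ
  obtain ⟨h1, h2, h⟩ := h
  simp only [List.length_append, SameSide] at hp' ⊢
  rcases h with ⟨hp, hq, h⟩ | ⟨hp, hq, h⟩
  · by_cases hp'u : p' < u.length
    · obtain ⟨q', hq', hs, hb⟩ := h.2.1 p' hp'u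
      exact ⟨q', by omega, hs, h1.pred, h2.pred, .inl ⟨hp'u, hq', hb⟩⟩
    · obtain ⟨q', hq', hb⟩ := h2.pred.1 (p' - u.length) (by omega)
      exact ⟨q' + v.length, by omega, by omega, h1.pred, h2.pred,
        .inr ⟨by omega, by omega, by rwa [Nat.add_sub_cancel]⟩⟩
  · by_cases hp'u : p' < u.length
    · obtain ⟨q', hq', hb⟩ := h1.pred.1 p' hp'u
      exact ⟨q', by omega, by omega, h1.pred, h2.pred, .inl ⟨by omega, by omega, hb⟩⟩
    · obtain ⟨q', hq', hs, hb⟩ := h.2.1 (p' - u.length) (by omega)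
      unfold SameSide at hs
      exact ⟨q' + v.length, by omega, by omega, h1.pred, h2.pred,
        .inr ⟨by omega, by omega, by rwa [Nat.add_sub_cancel]⟩⟩

theorem append_backForth {n : ℕ} {u u' v v' : List A} {p q : ℕ}
    (h : WordEquiv n u v) (h' : WordEquiv n u' v')
    (hb : (p < u.length ∧ q < v.length ∧ BackForth n u p v q) ∨
        (u.length ≤ p ∧ v.length ≤ q ∧ BackForth n u' (p - u.length) v' (q - v.length))) :
    BackForth n (u ++ u') p (v ++ v') q := by
  refine BackForth.of_bisim (n := n) (Z := fun m p q => WordEquiv m u v ∧ WordEquiv m u' v' ∧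
      ((p < u.length ∧ q < v.length ∧ BackForth m u p v q) ∨
        (u.length ≤ p ∧ v.length ≤ q ∧ BackForth m u' (p - u.length) v' (q - v.length))))
    ?_ ?_ ?_ le_rfl ⟨h, h', hb⟩
  · rintro m p q ⟨-, -, ⟨hp, hq, h⟩ | ⟨hp, hq, h⟩⟩
    · rw [List.getElem?_append_left hp, List.getElem?_append_left hq, h.letter]
    · rw [List.getElem?_append_right hp, List.getElem?_append_right hq, h.letter]
  · exact fun m p q _ h => append_forth rfl h
  · rintro m p q - ⟨h1, h2, h⟩ q' hq'
    obtain ⟨p', hp', hs, h1', h2', hz⟩ := append_forth (n := m) (u := v) (u' := v') (v := u)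
      (v' := u') (p := q) (q := p) rfl
      ⟨h1.symm, h2.symm, h.imp (fun h => ⟨h.2.1, h.1, h.2.2.symm⟩)
        (fun h => ⟨h.2.1, h.1, h.2.2.symm⟩)⟩ q' hq'
    exact ⟨p', hp', hs.symm, h1'.symm, h2'.symm, hz.imp (fun h => ⟨h.2.1, h.1, h.2.2.symm⟩)
        (fun h => ⟨h.2.1, h.1, h.2.2.symm⟩)⟩

theorem append_left {n : ℕ} {u u' v v' : List A} (h : WordEquiv n u v)
    (h' : WordEquiv n u' v') (p : ℕ) (hp : p < (u ++ u').length) :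
    ∃ q < (v ++ v').length, BackForth n (u ++ u') p (v ++ v') q := by
  simp only [List.length_append] at hp ⊢
  by_cases hpu : p < u.length
  · obtain ⟨q, hq, hb⟩ := h.1 p hpu
    exact ⟨q, by omega, append_backForth h h' (.inl ⟨hpu, hq, hb⟩)⟩
  · obtain ⟨q, hq, hb⟩ := h'.1 (p - u.length) (by omega)
    exact ⟨q + v.length, by omega, append_backForth h h'
      (.inr ⟨by omega, by omega, by rwa [Nat.add_sub_cancel]⟩)⟩

/-- Back-and-forth equivalence is a congruence. -/
theorem append {n : ℕ} {u u' v v' : List A} (h : WordEquiv n u v)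
    (h' : WordEquiv n u' v') : WordEquiv n (u ++ u') (v ++ v') := by
  refine ⟨append_left h h', fun q hq => ?_⟩
  obtain ⟨p, hp, hb⟩ := append_left h.symm h'.symm q hq
  exact ⟨p, hp, hb.symm⟩

end WordEquiv

end Game

/-! ### Words with many factors that contain every letter -/

section Arches

variable {A : Type*} {B : Finset A}

/-- `x` contains at least `n` disjoint factors each of which contains every letter of `B`. -/
def IsFull (B : Finset A) : ℕ → List A → Prop
  | 0, _ => True
  | n + 1, x => ∃ y z, x = y ++ z ∧ (∀ c ∈ B, c ∈ y) ∧ IsFull B n z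

namespace IsFull

theorem append_left {n : ℕ} {x : List A} (h : IsFull B n x) (y : List A) :
    IsFull B n (y ++ x) := by
  cases n with
  | zero => trivial
  | succ n =>
    obtain ⟨s, t, rfl, hs, ht⟩ := h
    exact ⟨y ++ s, t, by simp, fun c hc => List.mem_append_right _ (hs c hc), ht⟩

theorem append_right {n : ℕ} {x : List A} (h : IsFull B n x) (y : List A) :
    IsFull B n (x ++ y) := by
  induction n generalizing x with
  | zero => trivial
  | succ n ih =>
    obtain ⟨s, t, rfl, hs, ht⟩ := h
    exact ⟨s, t ++ y, by simp, hs, ih ht⟩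

theorem mono {m n : ℕ} (hmn : m ≤ n) {x : List A} (h : IsFull B n x) : IsFull B m x := by
  induction hmn with
  | refl => exact h
  | step _ ih =>
    obtain ⟨s, t, rfl, hs, ht⟩ := h
    exact ih (ht.append_left s)

theorem add_iff {m n : ℕ} {x : List A} :
    IsFull B (m + n) x ↔ ∃ y z, x = y ++ z ∧ IsFull B m y ∧ IsFull B n z := by
  induction m generalizing x with
  | zero =>
    rw [Nat.zero_add]
    refine ⟨fun h => ⟨[], x, rfl, trivial, h⟩, ?_⟩
    rintro ⟨y, z, rfl, -, h⟩
    exact h.append_left y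
  | succ m ih =>
    rw [show m + 1 + n = m + n + 1 by omega]
    constructor
    · rintro ⟨s, t, rfl, hs, ht⟩
      obtain ⟨y, z, rfl, hy, hz⟩ := ih.1 ht
      exact ⟨s ++ y, z, by simp, ⟨s, y, rfl, hs, hy⟩, hz⟩
    · rintro ⟨y, z, rfl, ⟨s, t, rfl, hs, ht⟩, hz⟩
      exact ⟨s, t ++ z, by simp, hs, ih.2 ⟨t, z, rfl, ht, hz⟩⟩

theorem one_iff {x : List A} : IsFull B 1 x ↔ ∀ c ∈ B, c ∈ x := by
  refine ⟨?_, fun h => ⟨x, [], by simp, h, trivial⟩⟩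
  rintro ⟨y, z, rfl, h, -⟩ c hc
  exact List.mem_append_left _ (h c hc)

theorem reverse {n : ℕ} {x : List A} (h : IsFull B n x) : IsFull B n x.reverse := by
  induction n generalizing x with
  | zero => trivial
  | succ n ih =>
    obtain ⟨s, t, rfl, hs, ht⟩ := h
    rw [List.reverse_append]
    exact add_iff.2 ⟨_, _, rfl, ih ht, one_iff.2 (by simpa using hs)⟩

theorem drop {n i j : ℕ} {x : List A} (hij : i ≤ j) (h : IsFull B n (x.drop j)) :
    IsFull B n (x.drop i) := by
  have : x.drop i = (x.drop i).take (j - i) ++ x.drop j := by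
    conv_lhs => rw [← List.take_append_drop (j - i) (x.drop i)]
    rw [List.drop_drop, Nat.add_sub_cancel' hij]
  rw [this]
  exact h.append_left _

theorem take {n i j : ℕ} {x : List A} (hij : i ≤ j) (h : IsFull B n (x.take i)) :
    IsFull B n (x.take j) := by
  have : x.take j = x.take i ++ (x.take j).drop i := by
    conv_lhs => rw [← List.take_append_drop i (x.take j)]
    rw [List.take_take, min_eq_left hij]
  rw [this]
  exact h.append_right _

/-- The price of a move: the first full factor supplies the letter, and the other `n` remain beyond
it. -/
theorem exists_ge {n j : ℕ} {x : List A} (h : IsFull B (n + 1) (x.drop j)) {c : A} (hc : c ∈ B) :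
    ∃ i ≥ j, i < x.length ∧ x[i]? = some c ∧ IsFull B n (x.drop (i + 1)) := by
  obtain ⟨y, z, hyz, hy, hz⟩ := h
  obtain ⟨i, hi, rfl⟩ := List.mem_iff_getElem.1 (hy c hc)
  have hget : x[j + i]? = some y[i] := by
    rw [← List.getElem?_drop, hyz, List.getElem?_append_left hi, List.getElem?_eq_getElem hi]
  refine ⟨j + i, by omega, (List.getElem?_eq_some_iff.1 hget).1, hget, ?_⟩
  rw [Nat.add_assoc, ← List.drop_drop, hyz, List.drop_append_of_le_length hi]
  exact hz.append_left _

theorem exists_lt {n j : ℕ} {x : List A} (h : IsFull B (n + 1) (x.take j)) {c : A} (hc : c ∈ B) :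
    ∃ i < j, i < x.length ∧ x[i]? = some c ∧ IsFull B n (x.take i) := by
  obtain ⟨y, z, hyz, hy, hz⟩ := add_iff.1 h
  obtain ⟨i, hi, rfl⟩ := List.mem_iff_getElem.1 (one_iff.1 hz c hc)
  have hlen := congrArg List.length hyz
  rw [List.length_take, List.length_append] at hlen
  refine ⟨y.length + i, by omega, by omega, ?_, ?_⟩
  · rw [← List.getElem?_take_of_lt (show y.length + i < j by omega), hyz,
      List.getElem?_append_right (by omega), Nat.add_sub_cancel_left, List.getElem?_eq_getElem hi]
  · have : x.take (y.length + i) = y ++ z.take i := by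
      rw [← List.take_length_add_append, ← hyz, List.take_take, min_eq_left (by omega)]
    rw [this]
    exact hy.append_right _

end IsFull

/-- The relation maintained by the second player on `x ++ z ++ y` and `x ++ z' ++ y`: the positions
agree in `x`, or agree in `y`, or both have enough full factors on both sides. -/
def MiddleRel (B : Finset A) (x z z' y : List A) (m p q : ℕ) : Prop :=
  p < (x ++ z ++ y).length ∧ q < (x ++ z' ++ y).length ∧
  (x ++ z ++ y)[p]? = (x ++ z' ++ y)[q]? ∧
  ((p = q ∧ p < x.length) ∨
    ((x ++ z).length ≤ p ∧ (x ++ z').length ≤ q ∧ p + z'.length = q + z.length) ∨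
    ((IsFull B m ((x ++ z ++ y).take p) ∧ IsFull B m ((x ++ z ++ y).drop (p + 1))) ∧
      IsFull B m ((x ++ z' ++ y).take q) ∧ IsFull B m ((x ++ z' ++ y).drop (q + 1))))

theorem MiddleRel.symm {x z z' y : List A} {m p q : ℕ} (h : MiddleRel B x z z' y m p q) :
    MiddleRel B x z' z y m q p := by
  obtain ⟨h1, h2, h3, h4⟩ := h
  refine ⟨h2, h1, h3.symm, ?_⟩
  rcases h4 with ⟨rfl, h⟩ | ⟨h, h', h''⟩ | ⟨h, h'⟩
  · exact .inl ⟨rfl, h⟩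
  · exact .inr (.inl ⟨h', h, h''.symm⟩)
  · exact .inr (.inr ⟨h', h⟩)

section Middle

variable {n : ℕ} {x z z' y : List A}

theorem middleRel_left {m p : ℕ} (hp : p < x.length) : MiddleRel B x z z' y m p p := by
  refine ⟨by simp; omega, by simp; omega, ?_, .inl ⟨rfl, hp⟩⟩
  rw [List.append_assoc, List.append_assoc, List.getElem?_append_left hp,
    List.getElem?_append_left hp]

theorem middleRel_right {m p : ℕ} (hp : p < (x ++ z ++ y).length) (hp' : (x ++ z).length ≤ p) :
    MiddleRel B x z z' y m p (p - z.length + z'.length) := by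
  simp only [List.length_append] at hp hp'
  refine ⟨by simp; omega, by simp; omega, ?_, .inr (.inl ?_)⟩
  · rw [List.getElem?_append_right (by simp; omega), List.getElem?_append_right (by simp; omega)]
    congr 1
    simp
    omega
  · simp only [List.length_append]
    omega

theorem isFull_take_append (hx : IsFull B n x) {m p : ℕ} (hm : m ≤ n) (hp : x.length ≤ p) :
    IsFull B m ((x ++ z ++ y).take p) := by
  refine IsFull.take hp ?_
  rw [List.append_assoc, List.take_left]
  exact hx.mono hm

theorem isFull_drop_append (hy : IsFull B n y) {m p : ℕ} (hm : m ≤ n)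
    (hp : p ≤ (x ++ z).length) : IsFull B m ((x ++ z ++ y).drop p) := by
  refine IsFull.drop hp ?_
  rw [List.drop_left]
  exact hy.mono hm

/-- A position of `z` is answered by a position to the right. -/
theorem exists_middleRel_ge (hB : ∀ a ∈ x ++ z ++ y, a ∈ B) {m p j : ℕ} (hp : p < (x ++ z ++ y).length)
    (hfl : IsFull B m ((x ++ z ++ y).take p)) (hfr : IsFull B m ((x ++ z ++ y).drop (p + 1)))
    (hj : IsFull B (m + 1) ((x ++ z' ++ y).drop j))
    (hj' : IsFull B m ((x ++ z' ++ y).take j)) :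
    ∃ q ≥ j, q < (x ++ z' ++ y).length ∧ MiddleRel B x z z' y m p q := by
  obtain ⟨q, hq, hql, hqc, hqf⟩ := hj.exists_ge (hB _ (List.getElem_mem hp))
  exact ⟨q, hq, hql, hp, hql, by rw [hqc, List.getElem?_eq_getElem hp],
    .inr (.inr ⟨⟨hfl, hfr⟩, hj'.take hq, hqf⟩)⟩

/-- A position of `z` is answered by a position to the left. -/
theorem exists_middleRel_lt (hB : ∀ a ∈ x ++ z ++ y, a ∈ B) {m p j : ℕ} (hp : p < (x ++ z ++ y).length)
    (hfl : IsFull B m ((x ++ z ++ y).take p)) (hfr : IsFull B m ((x ++ z ++ y).drop (p + 1)))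
    (hj : IsFull B (m + 1) ((x ++ z' ++ y).take j))
    (hj' : IsFull B m ((x ++ z' ++ y).drop j)) :
    ∃ q < j, q < (x ++ z' ++ y).length ∧ MiddleRel B x z z' y m p q := by
  obtain ⟨q, hq, hql, hqc, hqf⟩ := hj.exists_lt (hB _ (List.getElem_mem hp))
  exact ⟨q, hq, hql, hp, hql, by rw [hqc, List.getElem?_eq_getElem hp],
    .inr (.inr ⟨⟨hfl, hfr⟩, hqf, hj'.drop hq⟩)⟩

/-- Positions in the common words `x` and `y` can be copied, and any other position can be replaced
by one with the same letter at the cost of one full factor. What must be checked is that copying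
respects the order when the previous pebbles were not copies. -/
theorem MiddleRel.forth (hx : IsFull B n x) (hy : IsFull B n y)
    (hB : ∀ a ∈ x ++ z ++ y, a ∈ B) {m p q : ℕ} (hm : m < n)
    (h : MiddleRel B x z z' y (m + 1) p q) (p' : ℕ) (hp' : p' < (x ++ z ++ y).length) :
    ∃ q' < (x ++ z' ++ y).length, SameSide p p' q q' ∧ MiddleRel B x z z' y m p' q' := by
  obtain ⟨hp, hq, hpq, h⟩ := h
  have hlen : (x ++ z).length = x.length + z.length := List.length_append
  have hlen' : (x ++ z').length = x.length + z'.length := List.length_append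
  unfold SameSide
  rcases h with ⟨rfl, hpx⟩ | ⟨hpz, hqz, hpq'⟩ | ⟨⟨hpl, hpr⟩, hql, hqr⟩
  · by_cases h1 : p' < x.length
    · have := middleRel_left (B := B) (z := z) (z' := z') (y := y) (m := m) h1
      exact ⟨p', this.2.1, by omega, this⟩
    by_cases h2 : (x ++ z).length ≤ p'
    · have := middleRel_right (B := B) (z' := z') (m := m) hp' h2
      exact ⟨_, this.2.1, by omega, this⟩
    -- The old pebble lies in `x` and the new one in `z`, to its right; the answer is sought in `y`.
    obtain ⟨q', hq', hq'l, hr⟩ := exists_middleRel_ge (z' := z') (m := m)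
      (j := (x ++ z').length) hB hp'
      (isFull_take_append hx hm.le (by omega)) (isFull_drop_append hy hm.le (by omega))
      (isFull_drop_append hy hm le_rfl) (isFull_take_append hx hm.le (by omega))
    exact ⟨q', hq'l, by omega, hr⟩
  · by_cases h1 : p' < x.length
    · have := middleRel_left (B := B) (z := z) (z' := z') (y := y) (m := m) h1
      exact ⟨p', this.2.1, by omega, this⟩
    by_cases h2 : (x ++ z).length ≤ p'
    · have := middleRel_right (B := B) (z' := z') (m := m) hp' h2
      exact ⟨_, this.2.1, by omega, this⟩
    obtain ⟨q', hq', hq'l, hr⟩ := exists_middleRel_lt (z' := z') (m := m) (j := x.length)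
      hB hp'
      (isFull_take_append hx hm.le (by omega)) (isFull_drop_append hy hm.le (by omega))
      (isFull_take_append hx hm le_rfl) (isFull_drop_append hy hm.le (by omega))
    exact ⟨q', hq'l, by omega, hr⟩
  -- The old pebbles have `m + 1` full factors on both sides. If the new one has `m` on both sides,
  -- a factor next to `q` supplies the answer; otherwise it is close to an end of the word, hence in
  -- `x` or `y`, and is copied.
  · by_cases h1 : IsFull B m ((x ++ z ++ y).take p')
    · by_cases h2 : IsFull B m ((x ++ z ++ y).drop (p' + 1))
      · rcases lt_trichotomy p' p with hlt | rfl | hlt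
        · obtain ⟨q', hq', hq'l, hr⟩ := exists_middleRel_lt (z' := z') (m := m) (j := q)
            hB hp' h1 h2 hql ((hqr.mono m.le_succ).drop q.le_succ)
          exact ⟨q', hq'l, by omega, hr⟩
        · exact ⟨q, hq, by omega, hp', hq, hpq, .inr (.inr ⟨⟨h1, h2⟩,
            hql.mono m.le_succ, hqr.mono m.le_succ⟩)⟩
        · obtain ⟨q', hq', hq'l, hr⟩ := exists_middleRel_ge (z' := z') (m := m) (j := q + 1)
            hB hp' h1 h2 hqr ((hql.mono m.le_succ).take q.le_succ)
          exact ⟨q', hq'l, by omega, hr⟩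
      · have h3 : (x ++ z).length ≤ p' := by
          by_contra hc
          exact h2 (isFull_drop_append hy hm.le (by omega))
        have hr := middleRel_right (B := B) (z' := z') (m := m) hp' h3
        refine ⟨_, hr.2.1, ?_, hr⟩
        have h4 : p < p' := by
          by_contra hc
          exact h2 ((hpr.mono m.le_succ).drop (by omega))
        -- Otherwise the suffix behind the copy would inherit fullness from the one behind `q`, but
        -- it equals the suffix behind `p'`.
        have h5 : q < p' - z.length + z'.length := by
          by_contra hc
          refine h2 ?_
          have := (hqr.mono m.le_succ).drop (i := p' - z.length + z'.length + 1) (by omega)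
          rw [List.drop_append, List.drop_eq_nil_of_le (by omega), List.nil_append] at this ⊢
          rwa [show p' + 1 - (x ++ z).length
            = p' - z.length + z'.length + 1 - (x ++ z').length by omega]
        omega
    · have h3 : p' < x.length := by
        by_contra hc
        exact h1 (isFull_take_append hx hm.le (by omega))
      have hr := middleRel_left (B := B) (z := z) (z' := z') (y := y) (m := m) h3
      refine ⟨_, hr.2.1, ?_, hr⟩
      have h4 : p' < p := by
        by_contra hc
        exact h1 ((hpl.mono m.le_succ).take (by omega))
      have h5 : p' < q := by
        by_contra hc
        refine h1 ?_
        have := (hql.mono m.le_succ).take (j := p') (by omega)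
        rw [List.append_assoc, List.take_append_of_le_length h3.le] at this ⊢
        exact this
      omega

theorem exists_backForth_of_isFull (hx : IsFull B (n + 1) x) (hy : IsFull B (n + 1) y)
    (hB : ∀ a ∈ x ++ z ++ y, a ∈ B) (hB' : ∀ a ∈ x ++ z' ++ y, a ∈ B) (p : ℕ)
    (hp : p < (x ++ z ++ y).length) :
    ∃ q < (x ++ z' ++ y).length, BackForth n (x ++ z ++ y) p (x ++ z' ++ y) q := by
  suffices h : ∃ q, MiddleRel B x z z' y n p q by
    obtain ⟨q, hq⟩ := h
    refine ⟨q, hq.2.1, BackForth.of_bisim (n := n) (fun m p q h => h.2.2.1) ?_ ?_ le_rfl hq⟩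
    · exact fun m p q hm h => h.forth hx hy hB (by omega)
    · intro m p q hm h q' hq'
      obtain ⟨p', hp', hs, hr⟩ := h.symm.forth hx hy hB' (by omega) q' hq'
      exact ⟨p', hp', hs.symm, hr.symm⟩
  have hlen : (x ++ z).length = x.length + z.length := List.length_append
  have hlen' : (x ++ z').length = x.length + z'.length := List.length_append
  by_cases h1 : p < x.length
  · exact ⟨p, middleRel_left h1⟩
  by_cases h2 : (x ++ z).length ≤ p
  · exact ⟨_, middleRel_right hp h2⟩
  -- Answering an opening move in `z` already spends one full factor of `y`, whence `n + 1` of them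
  -- for `n` rounds.
  obtain ⟨q, -, -, hr⟩ := exists_middleRel_ge (z' := z') (m := n) (j := (x ++ z').length) hB hp
    (isFull_take_append hx n.le_succ (by omega)) (isFull_drop_append hy n.le_succ (by omega))
    (isFull_drop_append hy le_rfl le_rfl) (isFull_take_append hx n.le_succ (by omega))
  exact ⟨q, hr⟩

/-- Between `n + 1`-full words, any factor may be exchanged for any other. -/
theorem wordEquiv_of_isFull (hx : IsFull B (n + 1) x) (hy : IsFull B (n + 1) y)
    (hB : ∀ a ∈ x ++ z ++ y, a ∈ B) (hB' : ∀ a ∈ x ++ z' ++ y, a ∈ B) :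
    WordEquiv n (x ++ z ++ y) (x ++ z' ++ y) := by
  refine ⟨exists_backForth_of_isFull hx hy hB hB', fun q hq => ?_⟩
  obtain ⟨p, hp, hb⟩ := exists_backForth_of_isFull hx hy hB' hB q hq
  exact ⟨p, hp, hb.symm⟩

end Middle

/-! ### Greedy factorizations -/

open Classical in
/-- For every letter `c` of `B`, the factorizations of `u` and `v` at the first occurrence of `c`
agree: the prefixes are equivalent at depth `n`, and the rests agree in the same sense, for
`N` steps. -/
def GreedyEquiv (B : Finset A) (n : ℕ) : ℕ → List A → List A → Prop
  | 0, _, _ => True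
  | N + 1, u, v => ∀ c ∈ B, (c ∈ u ↔ c ∈ v) ∧
      WordEquiv n (u.take (u.idxOf c)) (v.take (v.idxOf c)) ∧
      GreedyEquiv B n N (u.drop (u.idxOf c + 1)) (v.drop (v.idxOf c + 1))

open Classical in
theorem take_idxOf_append_drop {u : List A} {c : A} (hc : c ∈ u) :
    u = u.take (u.idxOf c) ++ [c] ++ u.drop (u.idxOf c + 1) := by
  have h := List.idxOf_lt_length_of_mem hc
  conv_lhs => rw [← List.take_append_drop (u.idxOf c) u, List.drop_eq_getElem_cons h,
    List.getElem_idxOf h]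
  simp

open Classical in
theorem mem_take_idxOf {u : List A} {c d : A} (hd : d ∈ u) (h : u.idxOf d < u.idxOf c) :
    d ∈ u.take (u.idxOf c) := by
  have hl := List.idxOf_lt_length_of_mem hd
  rw [List.mem_take_iff_getElem]
  exact ⟨u.idxOf d, by omega, List.getElem_idxOf hl⟩

open Classical in
-- As long as all letters of `B` occur, cutting at the one that appears last yields a full factor,
-- and its counterpart in `v` is full because equivalent words have the same letters. The process
-- ends after `N` cuts or when a letter is missing.
theorem GreedyEquiv.wordEquiv_or {n N : ℕ} {u v : List A} (hu : ∀ a ∈ u, a ∈ B)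
    (hv : ∀ a ∈ v, a ∈ B) (h : GreedyEquiv B n N u v) :
    WordEquiv n u v ∨ ∃ x y x' y', u = x ++ y ∧ v = x' ++ y' ∧ WordEquiv n x x' ∧
      IsFull B N x ∧ IsFull B N x' := by
  induction N generalizing u v with
  | zero => exact .inr ⟨[], u, [], v, rfl, rfl, .refl n _, trivial, trivial⟩
  | succ N ih =>
    by_cases hall : ∀ c ∈ B, c ∈ u
    · by_cases hB : B.Nonempty
      -- All other letters of `B` occur before the first `c`.
      · obtain ⟨c, hc, hmax⟩ := B.exists_max_image (fun c => u.idxOf c) hB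
        obtain ⟨hcv, he, hg⟩ := h c hc
        have hfull : ∀ d ∈ B, d ≠ c → d ∈ u.take (u.idxOf c) := fun d hd hdc =>
          mem_take_idxOf (hall d hd) (lt_of_le_of_ne (hmax d hd) fun h =>
            hdc ((List.idxOf_inj (hall d hd)).1 h))
        have hu' := take_idxOf_append_drop (hall c hc)
        have hv' := take_idxOf_append_drop (hcv.1 (hall c hc))
        have he' := he.append (.refl n [c])
        have hf1 : ∀ d ∈ B, d ∈ u.take (u.idxOf c) ++ [c] := fun d hd => by
          by_cases hdc : d = c
          · simp [hdc]
          · exact List.mem_append_left _ (hfull d hd hdc)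
        have hf2 : ∀ d ∈ B, d ∈ v.take (v.idxOf c) ++ [c] := fun d hd => he'.mem (hf1 d hd)
        rcases ih (fun a ha => hu a (List.mem_of_mem_drop ha))
          (fun a ha => hv a (List.mem_of_mem_drop ha)) hg with
          hw | ⟨x, y, x', y', hx, hx', hw, hxf, hxf'⟩
        · left
          rw [hu', hv']
          exact he'.append hw
        · right
          refine ⟨_ ++ x, y, _ ++ x', y', ?_, ?_, he'.append hw, ⟨_, x, rfl, hf1, hxf⟩,
            ⟨_, x', rfl, hf2, hxf'⟩⟩
          · rw [List.append_assoc, ← hx]; exact hu'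
          · rw [List.append_assoc, ← hx']; exact hv'
      · rw [Finset.not_nonempty_iff_eq_empty] at hB
        subst hB
        left
        rw [List.eq_nil_iff_forall_not_mem.2 fun a ha => absurd (hu a ha) (by simp),
          List.eq_nil_iff_forall_not_mem.2 fun a ha => absurd (hv a ha) (by simp)]
        exact .refl n _
    · push Not at hall
      obtain ⟨c, hc, hcu⟩ := hall
      left
      -- For a missing letter the prefix before its first occurrence is the whole word.
      obtain ⟨hcv, he, -⟩ := h c hc
      rwa [List.idxOf_eq_length hcu, List.idxOf_eq_length fun h => hcu (hcv.2 h),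
        List.take_length, List.take_length] at he

/-- Greedy factorizations from both ends determine the equivalence class. -/
theorem GreedyEquiv.wordEquiv {n : ℕ} {u v : List A} (hu : ∀ a ∈ u, a ∈ B) (hv : ∀ a ∈ v, a ∈ B)
    (h : GreedyEquiv B n (n + 1 + (n + 1)) u v)
    (h' : GreedyEquiv B n (n + 1) u.reverse v.reverse) : WordEquiv n u v := by
  rcases h.wordEquiv_or hu hv with hw | ⟨p, y, p', y', hp, hp', hpw, hpf, hpf'⟩
  · exact hw
  rcases h'.wordEquiv_or (by simpa using hu) (by simpa using hv) with
    hw | ⟨q, z, q', z', hq, hq', hqw, hqf, hqf'⟩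
  · simpa using hw.reverse
  -- The prefix `p` and the suffix `q.reverse` may overlap in `u`. With `p = p₁ ++ p₂`, inserting
  -- `p₂ ++ p₁` after `p₁` turns `u` into `p ++ u`, where they are disjoint; then the middle is
  -- deleted. Both halves of `p` must be `n + 1`-full, which explains the doubled constant.
  have key : ∀ {u p y q z : List A}, (∀ a ∈ u, a ∈ B) → u = p ++ y → u.reverse = q ++ z →
      IsFull B (n + 1 + (n + 1)) p → IsFull B (n + 1) q → WordEquiv n u (p ++ q.reverse) := by
    intro u p y q z hu hp hq hpf hqf
    have hqu : u = z.reverse ++ q.reverse := by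
      rw [← List.reverse_append, ← hq, List.reverse_reverse]
    obtain ⟨p₁, p₂, rfl, h1, h2⟩ := IsFull.add_iff.1 hpf
    have hpB : ∀ a ∈ p₁ ++ p₂, a ∈ B := fun a ha => hu a (hp ▸ List.mem_append_left _ ha)
    have hyB : ∀ a ∈ y, a ∈ B := fun a ha => hu a (hp ▸ List.mem_append_right _ ha)
    have hzB : ∀ a ∈ z.reverse, a ∈ B := fun a ha => hu a (hqu ▸ List.mem_append_left _ ha)
    have hqB : ∀ a ∈ q.reverse, a ∈ B := fun a ha => hu a (hqu ▸ List.mem_append_right _ ha)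
    simp only [List.mem_append] at hpB
    have e1 : WordEquiv n (p₁ ++ [] ++ (p₂ ++ y)) (p₁ ++ (p₂ ++ p₁) ++ (p₂ ++ y)) := by
      refine wordEquiv_of_isFull h1 (h2.append_right y) ?_ ?_ <;>
      · intro a ha
        simp only [List.mem_append, List.not_mem_nil] at ha
        grind
    have e2 : WordEquiv n ((p₁ ++ p₂) ++ z.reverse ++ q.reverse) ((p₁ ++ p₂) ++ [] ++ q.reverse) := by
      refine wordEquiv_of_isFull (hpf.mono (by omega)) hqf.reverse ?_ ?_ <;>
      · intro a ha
        simp only [List.mem_append, List.not_mem_nil] at ha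
        grind
    have e3 : p₁ ++ (p₂ ++ p₁) ++ (p₂ ++ y) = (p₁ ++ p₂) ++ z.reverse ++ q.reverse := by
      rw [List.append_assoc _ z.reverse, ← hqu, hp]
      simp
    rw [e3] at e1
    have e4 := e1.trans e2
    rw [List.append_nil, List.append_nil, ← List.append_assoc, ← hp] at e4
    exact e4
  exact (key hu hp hq hpf hqf).trans
    ((hpw.append hqw.reverse).trans (key hv hp' hq' hpf' hqf').symm)

end Arches

/-! ### Constructions on formulas -/

namespace FO2Formula

section Formulas

variable {A : Type*}

/-- The quantifier depth. -/
def depth : FO2Formula A → ℕ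
  | falsum => 0
  | lt _ _ => 0
  | eq _ _ => 0
  | letter _ _ => 0
  | neg φ => φ.depth
  | and φ ψ => max φ.depth ψ.depth
  | or φ ψ => max φ.depth ψ.depth
  | ex _ φ => φ.depth + 1
  | all _ φ => φ.depth + 1

theorem eq_or_eq_one_sub (x y : Fin 2) : y = x ∨ y = 1 - x := by
  revert x y; decide

theorem one_sub_ne (x : Fin 2) : 1 - x ≠ x := by
  revert x; decide

/-- Two assignments that are related for `n` more rounds of the game. -/
def AssignEquiv (n : ℕ) (u w : List A) (v v' : Fin 2 → ℕ) : Prop :=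
  (∀ x, v x < u.length ∧ v' x < w.length ∧ BackForth n u (v x) w (v' x)) ∧
    ∀ x y, v x < v y ↔ v' x < v' y

theorem AssignEquiv.symm {n : ℕ} {u w : List A} {v v' : Fin 2 → ℕ}
    (h : AssignEquiv n u w v v') : AssignEquiv n w u v' v :=
  ⟨fun x => ⟨(h.1 x).2.1, (h.1 x).1, (h.1 x).2.2.symm⟩, fun x y => (h.2 x y).symm⟩

/-- Requantifying `x` forgets its old position, so only the order relative to the other variable has
to be preserved. This is why the game needs to remember just one position per word. -/
theorem AssignEquiv.forth {n : ℕ} {u w : List A} {v v' : Fin 2 → ℕ}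
    (h : AssignEquiv (n + 1) u w v v') (x : Fin 2) {i : ℕ} (hi : i < u.length) :
    ∃ j < w.length, AssignEquiv n u w (Function.update v x i) (Function.update v' x j) := by
  obtain ⟨h1, h2, hb⟩ := h.1 (1 - x)
  obtain ⟨j, hj, hs, hb'⟩ := hb.2.1 i hi
  refine ⟨j, hj, fun y => ?_, fun y z => ?_⟩
  · rcases eq_or_eq_one_sub x y with rfl | rfl
    · simp only [Function.update_self]
      exact ⟨hi, hj, hb'⟩
    · simp only [Function.update_of_ne (one_sub_ne x)]
      exact ⟨h1, h2, hb.pred⟩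
  · unfold SameSide at hs
    have hx : ∀ t : Fin 2, t = x ∨ t = 1 - x := fun t => eq_or_eq_one_sub x t
    rcases hx y with hy | hy <;> rcases hx z with hz | hz <;>
      simp only [hy, hz, Function.update_self, Function.update_of_ne (one_sub_ne x),
        lt_irrefl, hs]

theorem sat_iff_of_assignEquiv {u w : List A} (φ : FO2Formula A) {n : ℕ} (hn : φ.depth ≤ n)
    {v v' : Fin 2 → ℕ} (h : AssignEquiv n u w v v') : φ.Sat u v ↔ φ.Sat w v' := by
  induction φ generalizing n v v' with
  | falsum => rfl
  | lt x y => exact h.2 x y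
  | eq x y =>
    have h1 := h.2 x y
    have h2 := h.2 y x
    simp only [Sat]
    omega
  | letter a x => simp only [Sat, (h.1 x).2.2.letter]
  | neg φ ih => exact not_congr (ih hn h)
  | and φ ψ ih₁ ih₂ =>
    exact and_congr (ih₁ (le_trans (le_max_left _ _) hn) h) (ih₂ (le_trans (le_max_right _ _) hn) h)
  | or φ ψ ih₁ ih₂ =>
    exact or_congr (ih₁ (le_trans (le_max_left _ _) hn) h) (ih₂ (le_trans (le_max_right _ _) hn) h)
  | ex x φ ih =>
    obtain ⟨n, rfl⟩ : ∃ m, n = m + 1 := ⟨n - 1, by simp only [depth] at hn; omega⟩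
    have hn' : φ.depth ≤ n := by simp only [depth] at hn; omega
    constructor
    · rintro ⟨i, hi, hs⟩
      obtain ⟨j, hj, he⟩ := h.forth x hi
      exact ⟨j, hj, (ih hn' he).1 hs⟩
    · rintro ⟨j, hj, hs⟩
      obtain ⟨i, hi, he⟩ := h.symm.forth x hj
      exact ⟨i, hi, (ih hn' he.symm).2 hs⟩
  | all x φ ih =>
    obtain ⟨n, rfl⟩ : ∃ m, n = m + 1 := ⟨n - 1, by simp only [depth] at hn; omega⟩
    have hn' : φ.depth ≤ n := by simp only [depth] at hn; omega
    constructor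
    · intro hs j hj
      obtain ⟨i, hi, he⟩ := h.symm.forth x hj
      exact (ih hn' he.symm).1 (hs i hi)
    · intro hs i hi
      obtain ⟨j, hj, he⟩ := h.forth x hi
      exact (ih hn' he).2 (hs j hj)

/-- Equivalent words satisfy the same sentences of bounded depth. -/
theorem IsSentence.sat_of_wordEquiv {φ : FO2Formula A} (hφ : φ.IsSentence) {u w : List A}
    (h : WordEquiv φ.depth u w) (hs : φ.Sat u fun _ => 0) : φ.Sat w fun _ => 0 := by
  by_cases hu : 0 < u.length
  · obtain ⟨q, hq, hb⟩ := h.1 0 hu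
    -- Both variables start on one position; a sentence does not depend on the assignment.
    have := (sat_iff_of_assignEquiv φ le_rfl (v := fun _ => 0) (v' := fun _ => q)
      ⟨fun _ => ⟨hu, hq, hb⟩, fun _ _ => by simp⟩).1 hs
    exact (hφ.sat_iff w _ _).1 this
  · have hw : ¬ 0 < w.length := fun hw => by
      obtain ⟨p, hp, -⟩ := h.2 0 hw
      omega
    rw [List.length_pos_iff, not_not] at hu hw
    rwa [hw, ← hu]

/-- Exchanging `<` and `>`. -/
def flip : FO2Formula A → FO2Formula A
  | falsum => falsum
  | lt x y => lt y x
  | eq x y => eq x y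
  | letter a x => letter a x
  | neg φ => neg φ.flip
  | and φ ψ => and φ.flip ψ.flip
  | or φ ψ => or φ.flip ψ.flip
  | ex x φ => ex x φ.flip
  | all x φ => all x φ.flip

theorem freeVars_flip (φ : FO2Formula A) : φ.flip.freeVars = φ.freeVars := by
  induction φ with
  | lt x y => exact Finset.pair_comm _ _
  | _ => simp_all [flip, freeVars]

theorem blocksFrom_flip (φ : FO2Formula A) (pos : Bool) (cur : Option Bool) :
    φ.flip.blocksFrom pos cur = φ.blocksFrom pos cur := by
  induction φ generalizing pos cur <;> simp only [flip, blocksFrom, *]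

theorem sat_flip (w : List A) (φ : FO2Formula A) (v v' : Fin 2 → ℕ)
    (h : ∀ x ∈ φ.freeVars, v x + v' x + 1 = w.length) : φ.flip.Sat w v ↔ φ.Sat w.reverse v' := by
  have upd : ∀ (x : Fin 2) (φ : FO2Formula A) (v v' : Fin 2 → ℕ),
      (∀ y ∈ φ.freeVars.erase x, v y + v' y + 1 = w.length) → ∀ i j, i + j + 1 = w.length →
      ∀ y ∈ φ.freeVars, Function.update v x i y + Function.update v' x j y + 1 = w.length := by
    intro x φ v v' h i j hij y hy
    by_cases hyx : y = x
    · subst hyx; simpa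
    · simpa [Function.update_of_ne hyx] using h y (Finset.mem_erase.2 ⟨hyx, hy⟩)
  induction φ generalizing v v' with
  | falsum => rfl
  | lt x y =>
    have h1 := h x (by simp [freeVars])
    have h2 := h y (by simp [freeVars])
    simp only [flip, Sat]
    omega
  | eq x y =>
    have h1 := h x (by simp [freeVars])
    have h2 := h y (by simp [freeVars])
    simp only [flip, Sat]
    omega
  | letter a x =>
    have h1 := h x (by simp [freeVars])
    simp only [flip, Sat]
    rw [List.getElem?_reverse (by omega), show w.length - 1 - v' x = v x by omega]
  | neg φ ih => exact not_congr (ih v v' h)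
  | and φ ψ ih₁ ih₂ =>
    exact and_congr (ih₁ v v' fun x hx => h x (Finset.mem_union_left _ hx))
      (ih₂ v v' fun x hx => h x (Finset.mem_union_right _ hx))
  | or φ ψ ih₁ ih₂ =>
    exact or_congr (ih₁ v v' fun x hx => h x (Finset.mem_union_left _ hx))
      (ih₂ v v' fun x hx => h x (Finset.mem_union_right _ hx))
  | ex x φ ih =>
    simp only [flip, Sat, List.length_reverse]
    constructor
    · rintro ⟨i, hi, hs⟩
      exact ⟨w.length - 1 - i, by omega, (ih _ _ (upd x φ v v' h _ _ (by omega))).1 hs⟩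
    · rintro ⟨i, hi, hs⟩
      exact ⟨w.length - 1 - i, by omega, (ih _ _ (upd x φ v v' h _ _ (by omega))).2 hs⟩
  | all x φ ih =>
    simp only [flip, Sat, List.length_reverse]
    constructor
    · intro hs i hi
      exact (ih _ _ (upd x φ v v' h _ _ (by omega))).1 (hs (w.length - 1 - i) (by omega))
    · intro hs i hi
      exact (ih _ _ (upd x φ v v' h _ _ (by omega))).2 (hs (w.length - 1 - i) (by omega))

/-- Relativization of all quantifiers to the positions that satisfy `I`. -/
def relativize (I : Fin 2 → FO2Formula A) : FO2Formula A → FO2Formula A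
  | falsum => falsum
  | lt x y => lt x y
  | eq x y => eq x y
  | letter a x => letter a x
  | neg φ => neg (φ.relativize I)
  | and φ ψ => and (φ.relativize I) (ψ.relativize I)
  | or φ ψ => or (φ.relativize I) (ψ.relativize I)
  | ex x φ => ex x (and (I x) (φ.relativize I))
  | all x φ => all x (or (neg (I x)) (φ.relativize I))

theorem freeVars_relativize {I : Fin 2 → FO2Formula A} (hI : ∀ x, (I x).freeVars ⊆ {x})
    (φ : FO2Formula A) : (φ.relativize I).freeVars ⊆ φ.freeVars := by
  have aux : ∀ (x : Fin 2) (s t : Finset (Fin 2)), t ⊆ s →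
      ((I x).freeVars ∪ t).erase x ⊆ s.erase x := by
    intro x s t hst y hy
    rw [Finset.mem_erase, Finset.mem_union] at hy
    rcases hy with ⟨hyx, hy | hy⟩
    · exact absurd (Finset.mem_singleton.1 (hI x hy)) hyx
    · exact Finset.mem_erase.2 ⟨hyx, hst hy⟩
  induction φ with
  | and φ ψ ih₁ ih₂ => exact Finset.union_subset_union ih₁ ih₂
  | or φ ψ ih₁ ih₂ => exact Finset.union_subset_union ih₁ ih₂
  | neg φ ih => exact ih
  | ex x φ ih => exact aux x _ _ ih
  | all x φ ih => exact aux x _ _ ih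
  | _ => exact subset_rfl

/-- A guard stands beside the relativized body, not above it. A path that enters a guard never
returns to `φ`, so guards do not accumulate and at most one block is added. -/
theorem blocksFrom_relativize {I : Fin 2 → FO2Formula A}
    (hI : ∀ x pos cur, (I x).blocksFrom pos cur ≤ 1) (φ : FO2Formula A) (pos : Bool)
    (cur : Option Bool) : (φ.relativize I).blocksFrom pos cur ≤ φ.blocksFrom pos cur + 1 := by
  induction φ generalizing pos cur with
  | neg φ ih => exact ih _ _
  | and φ ψ ih₁ ih₂ =>
    have h1 := ih₁ pos cur
    have h2 := ih₂ pos cur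
    simp only [relativize, blocksFrom]
    omega
  | or φ ψ ih₁ ih₂ =>
    have h1 := ih₁ pos cur
    have h2 := ih₂ pos cur
    simp only [relativize, blocksFrom]
    omega
  | ex x φ ih =>
    have h1 := ih pos (some pos)
    have h2 := hI x pos (some pos)
    simp only [relativize, blocksFrom]
    omega
  | all x φ ih =>
    have h1 := ih pos (some !pos)
    have h2 := hI x (!pos) (some !pos)
    simp only [relativize, blocksFrom]
    omega
  | _ => exact Nat.zero_le _

theorem sat_relativize {w : List A} {l m : ℕ} {I : Fin 2 → FO2Formula A}
    (hI : ∀ x v, v x < w.length → ((I x).Sat w v ↔ l ≤ v x ∧ v x < l + m)) (φ : FO2Formula A)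
    (v : Fin 2 → ℕ) (hv : ∀ x ∈ φ.freeVars, v x < ((w.drop l).take m).length) :
    (φ.relativize I).Sat w (fun x => l + v x) ↔ φ.Sat ((w.drop l).take m) v := by
  have upd : ∀ (x : Fin 2) (φ : FO2Formula A) (v : Fin 2 → ℕ),
      (∀ y ∈ φ.freeVars.erase x, v y < ((w.drop l).take m).length) →
      ∀ i < ((w.drop l).take m).length,
      ∀ y ∈ φ.freeVars, Function.update v x i y < ((w.drop l).take m).length := by
    intro x φ v h i hi y hy
    by_cases hyx : y = x
    · subst hyx; simpa using hi
    · rw [Function.update_of_ne hyx]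
      exact h y (Finset.mem_erase.2 ⟨hyx, hy⟩)
  have shift : ∀ (x : Fin 2) (v : Fin 2 → ℕ) (i : ℕ),
      Function.update (fun y => l + v y) x (l + i) = fun y => l + Function.update v x i y := by
    intro x v i
    funext y
    by_cases hyx : y = x
    · subst hyx; simp
    · simp [Function.update_of_ne hyx]
  have hlen : ((w.drop l).take m).length = min m (w.length - l) := by simp
  induction φ generalizing v with
  | falsum => rfl
  | lt x y => simp [relativize, Sat]
  | eq x y => simp [relativize, Sat]
  | letter a x =>
    have := hv x (by simp [freeVars])
    simp only [relativize, Sat]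
    rw [List.getElem?_take_of_lt (by omega), List.getElem?_drop]
  | neg φ ih => exact not_congr (ih v hv)
  | and φ ψ ih₁ ih₂ =>
    exact and_congr (ih₁ v fun x hx => hv x (Finset.mem_union_left _ hx))
      (ih₂ v fun x hx => hv x (Finset.mem_union_right _ hx))
  | or φ ψ ih₁ ih₂ =>
    exact or_congr (ih₁ v fun x hx => hv x (Finset.mem_union_left _ hx))
      (ih₂ v fun x hx => hv x (Finset.mem_union_right _ hx))
  | ex x φ ih =>
    simp only [relativize, Sat]
    constructor
    · rintro ⟨i, hi, hs, hs'⟩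
      rw [hI x _ (by simpa), Function.update_self] at hs
      obtain ⟨j, rfl⟩ := Nat.exists_eq_add_of_le hs.1
      rw [shift] at hs'
      exact ⟨j, by omega, (ih _ (upd x φ v hv j (by omega))).1 hs'⟩
    · rintro ⟨j, hj, hs⟩
      refine ⟨l + j, by omega, ?_, ?_⟩
      · rw [hI x _ (by simp; omega), Function.update_self]
        omega
      · rw [shift]
        exact (ih _ (upd x φ v hv j hj)).2 hs
  | all x φ ih =>
    simp only [relativize, Sat]
    constructor
    · intro hs j hj
      have h1 := hs (l + j) (by omega)
      rw [hI x _ (by simp; omega), Function.update_self, shift] at h1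
      exact (ih _ (upd x φ v hv j hj)).1 (h1.resolve_left (by omega))
    · intro hs i hi
      rw [hI x _ (by simpa), Function.update_self]
      by_cases hli : l ≤ i ∧ i < l + m
      · obtain ⟨j, rfl⟩ := Nat.exists_eq_add_of_le hli.1
        rw [shift]
        exact .inr ((ih _ (upd x φ v hv j (by omega))).2 (hs j (by omega)))
      · exact .inl hli

/-- Some subword with reversal `s` lies to the left of `x`. -/
def beyond : List A → Fin 2 → FO2Formula A
  | [], _ => neg falsum
  | a :: s, x => ex (1 - x) (and (lt (1 - x) x) (and (letter a (1 - x)) (beyond s (1 - x))))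

theorem freeVars_beyond (s : List A) (x : Fin 2) : (beyond s x).freeVars ⊆ {x} := by
  induction s generalizing x with
  | nil => simp [beyond, freeVars]
  | cons a s ih =>
    intro y hy
    have := ih (1 - x)
    simp only [beyond, freeVars, Finset.mem_erase, Finset.mem_union, Finset.mem_insert,
      Finset.mem_singleton] at hy ⊢
    exact (eq_or_eq_one_sub x y).resolve_right hy.1

/-- All quantifiers of `beyond` are of one kind, so they merge with an enclosing block of that kind.
-/
theorem blocksFrom_beyond_self (s : List A) (x : Fin 2) (pos : Bool) :
    (beyond s x).blocksFrom pos (some pos) = 0 := by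
  induction s generalizing x with
  | nil => rfl
  | cons a s ih => simp [beyond, blocksFrom, ih]

theorem blocksFrom_beyond (s : List A) (x : Fin 2) (pos : Bool) (cur : Option Bool) :
    (beyond s x).blocksFrom pos cur ≤ 1 := by
  cases s with
  | nil => simp [beyond, blocksFrom]
  | cons a s =>
    simp only [beyond, blocksFrom, blocksFrom_beyond_self]
    split <;> simp

end Formulas

end FO2Formula

/-! ### Greedy cut positions and the formulas that locate them -/

section Cut

variable {A : Type*}

open Classical in
/-- The length of the shortest prefix of `w` of which `s.reverse` is a subword; a number greater
than `w.length` if there is none. -/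
noncomputable def cut : List A → List A → ℕ
  | [], _ => 0
  | a :: s, w => cut s w + (w.drop (cut s w)).idxOf a + 1

open FO2Formula

/-- The greedy embedding is leftmost: in any embedding the next letter comes no earlier than in the
greedy one. If there is no embedding, `cut s w` exceeds the length and both sides fail. -/
theorem sat_beyond (w s : List A) (x : Fin 2) (v : Fin 2 → ℕ) (hv : v x ≤ w.length) :
    (beyond s x).Sat w v ↔ cut s w ≤ v x := by
  classical
  induction s generalizing x v with
  | nil => simp [beyond, Sat, cut]
  | cons a s ih =>
    simp only [beyond, Sat, cut, Function.update_self, Function.update_of_ne (one_sub_ne x).symm]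
    constructor
    · rintro ⟨i, hi, hix, ha, hs⟩
      rw [ih _ _ (by simpa using hi.le), Function.update_self] at hs
      obtain ⟨j, rfl⟩ := Nat.exists_eq_add_of_le hs
      rw [← List.getElem?_drop] at ha
      have : (w.drop (cut s w)).idxOf a ≤ j := by
        by_contra hc
        obtain ⟨hj, ha⟩ := List.getElem?_eq_some_iff.1 ha
        exact absurd (List.not_of_lt_findIdx (p := (· == a)) (not_le.1 hc)) (by simp [ha])
      omega
    · intro h
      have hlt : (w.drop (cut s w)).idxOf a < (w.drop (cut s w)).length := by
        rw [List.length_drop]; omega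
      refine ⟨cut s w + (w.drop (cut s w)).idxOf a, by omega, by omega, ?_, ?_⟩
      · rw [← List.getElem?_drop, List.getElem?_eq_getElem hlt, List.getElem_idxOf hlt]
      · rw [ih _ _ (by rw [Function.update_self]; omega), Function.update_self]
        omega

/-- The position `x` lies behind the greedy occurrence of `s.reverse` and before the next `c`. -/
def inGap (s : List A) (c : A) (x : Fin 2) : FO2Formula A :=
  and (beyond s x) (neg (or (letter c x) (beyond (c :: s) x)))

open Classical in
theorem sat_inGap (w s : List A) (c : A) (x : Fin 2) (v : Fin 2 → ℕ) (hv : v x < w.length) :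
    (inGap s c x).Sat w v ↔
      cut s w ≤ v x ∧ v x < cut s w + (w.drop (cut s w)).idxOf c := by
  simp only [inGap, Sat, sat_beyond w _ x v hv.le]
  refine and_congr_right fun h => ?_
  simp only [cut]
  obtain ⟨j, hj⟩ := Nat.exists_eq_add_of_le h
  have hjl : j < (w.drop (cut s w)).length := by rw [List.length_drop]; omega
  rw [hj, ← List.getElem?_drop, List.getElem?_eq_getElem hjl, Option.some_inj]
  constructor
  · intro h
    by_contra hc
    -- `beyond (c :: s) x` excludes only the positions behind the next `c`; that `c` itself is
    -- excluded by its letter.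
    have : j = (w.drop (cut s w)).idxOf c := by omega
    subst this
    exact h (.inl (List.getElem_idxOf hjl))
  · rintro h (h' | h')
    · have hj' : j < (w.drop (cut s w)).idxOf c := by omega
      exact absurd (List.not_of_lt_findIdx (p := (· == c)) hj') (by simp [h'])
    · omega

end Cut

/-! ### Definability -/

section Definability

open FO2Formula

namespace FO2Formula

variable {A : Type*}

/-- Duality: negation exchanges the two kinds of quantifiers throughout and leaves the runs
unchanged. Hence each level is closed under complement. -/
theorem blocksFrom_not (φ : FO2Formula A) (pos : Bool) (cur : Option Bool) :
    φ.blocksFrom (!pos) (cur.map not) = φ.blocksFrom pos cur := by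
  induction φ generalizing pos cur with
  | neg φ ih => exact ih _ _
  | and φ ψ ih₁ ih₂ => simp only [blocksFrom, ih₁, ih₂]
  | or φ ψ ih₁ ih₂ => simp only [blocksFrom, ih₁, ih₂]
  | ex x φ ih =>
    have := ih pos (some pos)
    simp only [blocksFrom]
    rw [← this]
    rcases cur with _ | b
    · simp
    · cases b <;> cases pos <;> simp
  | all x φ ih =>
    have := ih pos (some !pos)
    simp only [blocksFrom]
    rw [← this]
    rcases cur with _ | b
    · simp
    · cases b <;> cases pos <;> simp
  | _ => rfl

theorem blocks_neg (φ : FO2Formula A) : (neg φ).blocks = φ.blocks :=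
  blocksFrom_not φ true none

theorem blocks_and (φ ψ : FO2Formula A) : (and φ ψ).blocks = max φ.blocks ψ.blocks := rfl

theorem blocks_or (φ ψ : FO2Formula A) : (or φ ψ).blocks = max φ.blocks ψ.blocks := rfl

/-- A sentence with `n` alternating quantifiers. -/
def alternating (A : Type*) : ℕ → FO2Formula A
  | 0 => falsum
  | n + 1 => ex 0 (neg (alternating A n))

theorem freeVars_alternating (n : ℕ) : (alternating A n).freeVars = ∅ := by
  induction n with
  | zero => rfl
  | succ n ih => simp [alternating, freeVars, ih]

theorem blocksFrom_alternating (n : ℕ) (pos : Bool) (cur : Option Bool) (h : cur ≠ some pos) :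
    (alternating A n).blocksFrom pos cur = n := by
  induction n generalizing pos cur with
  | zero => rfl
  | succ n ih =>
    simp only [alternating, blocksFrom, if_neg h]
    rw [ih _ _ (by cases pos <;> simp), Nat.add_comm]

/-- The number of blocks can be increased at will. -/
theorem IsSentence.exists_blocks_eq {φ : FO2Formula A} (hφ : φ.IsSentence) {k : ℕ}
    (hk : φ.blocks ≤ k) :
    ∃ ψ : FO2Formula A, ψ.IsSentence ∧ ψ.blocks = k ∧ ψ.language = φ.language := by
  -- The second conjunct is a tautology with exactly `k` blocks.
  refine ⟨and φ (or (alternating A k) (neg (alternating A k))), ?_, ?_, ?_⟩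
  · unfold IsSentence at hφ ⊢
    simp [freeVars, hφ, freeVars_alternating]
  · have : (alternating A k).blocks = k := blocksFrom_alternating k true none (by simp)
    rw [blocks_and, blocks_or, blocks_neg, this, max_self, max_eq_right hk]
  · ext w
    exact and_iff_left (em _)

end FO2Formula

variable {A : Type*}

/-- The words over the letters in `B`. -/
def wordsOver (B : Finset A) : Set (List A) := {w | ∀ a ∈ w, a ∈ B}

/-- The sets that some sentence with at most `k` blocks defines among the words over `B`. -/
def levelOver (B : Finset A) (k : ℕ) : Set (Set (List A)) :=
  {M | ∃ φ : FO2Formula A, φ.IsSentence ∧ φ.blocks ≤ k ∧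
    ∀ w ∈ wordsOver B, φ.Sat w (fun _ => 0) ↔ w ∈ M}

theorem isBooleanOn_levelOver (B : Finset A) (k : ℕ) :
    IsBooleanOn (wordsOver B) (levelOver B k) where
  univ_mem := ⟨neg falsum, rfl, Nat.zero_le _, fun w _ => by simp [Sat]⟩
  compl_mem := by
    rintro M ⟨φ, hφ, hk, h⟩
    exact ⟨neg φ, hφ, (blocks_neg φ).trans_le hk, fun w hw => not_congr (h w hw)⟩
  inter_mem := by
    rintro M ⟨φ, hφ, hk, h⟩ N ⟨ψ, hψ, hk', h'⟩
    refine ⟨and φ ψ, ?_, max_le hk hk', fun w hw => and_congr (h w hw) (h' w hw)⟩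
    unfold IsSentence at *
    simp [freeVars, hφ, hψ]
  congr_mem := by
    rintro M ⟨φ, hφ, hk, h⟩ N hN
    exact ⟨φ, hφ, hk, fun w hw => (h w hw).trans (hN w hw)⟩

/-- The sets of words with a position that are definable by a formula with one free variable,
whichever of the two variables this is. -/
def pointedDefinable (A : Type*) : Set (Set (List A × ℕ)) :=
  {M | ∀ x : Fin 2, ∃ φ : FO2Formula A, φ.freeVars ⊆ {x} ∧
    ∀ w v, v x < w.length → (φ.Sat w v ↔ (w, v x) ∈ M)}

theorem isBooleanOn_pointedDefinable :
    IsBooleanOn {x : List A × ℕ | x.2 < x.1.length} (pointedDefinable A) where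
  univ_mem := fun x => ⟨neg falsum, by simp [freeVars], fun w v _ => by simp [Sat]⟩
  compl_mem := by
    intro M hM x
    obtain ⟨φ, hφ, h⟩ := hM x
    exact ⟨neg φ, hφ, fun w v hv => not_congr (h w v hv)⟩
  inter_mem := by
    intro M hM N hN x
    obtain ⟨φ, hφ, h⟩ := hM x
    obtain ⟨ψ, hψ, h'⟩ := hN x
    exact ⟨and φ ψ, Finset.union_subset hφ hψ, fun w v hv => and_congr (h w v hv) (h' w v hv)⟩
  congr_mem := by
    intro M hM N hN x
    obtain ⟨φ, hφ, h⟩ := hM x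
    exact ⟨φ, hφ, fun w v hv => (h w v hv).trans (hN _ hv)⟩

/-- The new position is denoted by the other variable, so `M` must be definable with either variable
free. -/
theorem exists_lt_mem_pointedDefinable {M : Set (List A × ℕ)} (hM : M ∈ pointedDefinable A) :
    {x : List A × ℕ | ∃ q < x.1.length, q < x.2 ∧ (x.1, q) ∈ M} ∈ pointedDefinable A := by
  intro x
  obtain ⟨φ, hφ, h⟩ := hM (1 - x)
  refine ⟨ex (1 - x) (and (lt (1 - x) x) φ), ?_, fun w v hv => ?_⟩
  · intro y hy
    simp only [freeVars, Finset.mem_erase] at hy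
    exact Finset.mem_singleton.2 ((eq_or_eq_one_sub x y).resolve_right hy.1)
  · simp only [Sat, Function.update_self, Function.update_of_ne (one_sub_ne x).symm]
    refine exists_congr fun q => and_congr_right fun hq => and_congr_right fun _ => ?_
    rw [h _ _ (by simpa), Function.update_self]

theorem exists_gt_mem_pointedDefinable {M : Set (List A × ℕ)} (hM : M ∈ pointedDefinable A) :
    {x : List A × ℕ | ∃ q < x.1.length, x.2 < q ∧ (x.1, q) ∈ M} ∈ pointedDefinable A := by
  intro x
  obtain ⟨φ, hφ, h⟩ := hM (1 - x)
  refine ⟨ex (1 - x) (and (lt x (1 - x)) φ), ?_, fun w v hv => ?_⟩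
  · intro y hy
    simp only [freeVars, Finset.mem_erase] at hy
    exact Finset.mem_singleton.2 ((eq_or_eq_one_sub x y).resolve_right hy.1)
  · simp only [Sat, Function.update_self, Function.update_of_ne (one_sub_ne x).symm]
    refine exists_congr fun q => and_congr_right fun hq => and_congr_right fun _ => ?_
    rw [h _ _ (by simpa), Function.update_self]

/-- The points that lie in exactly those members of `S` that belong to `R`. -/
def cell {X : Type*} (S R : Set (Set X)) : Set X := {x | ∀ M ∈ S, M ∈ R ↔ x ∈ M}

theorem IsBooleanOn.cell_mem {X : Type*} {W : Set X} {𝒟 : Set (Set X)} (h : IsBooleanOn W 𝒟)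
    {S : Set (Set X)} (hS : S.Finite) (hSD : S ⊆ 𝒟) (R : Set (Set X)) : cell S R ∈ 𝒟 :=
  h.mem_of_saturated hS hSD _ fun _ _ _ _ huv hu M hM => (hu M hM).trans (huv M hM)

theorem mem_cell_self {X : Type*} (S : Set (Set X)) (x : X) : x ∈ cell S {M ∈ S | x ∈ M} :=
  fun _ hM => and_iff_right hM

theorem mem_iff_of_mem_cell {X : Type*} {S R : Set (Set X)} {x y : X} (hx : x ∈ cell S R)
    (hy : y ∈ cell S R) (M : Set X) (hM : M ∈ S) : x ∈ M ↔ y ∈ M :=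
  (hx M hM).symm.trans (hy M hM)

theorem letter_mem_pointedDefinable (a : A) :
    {x : List A × ℕ | x.1[x.2]? = some a} ∈ pointedDefinable A :=
  fun x => ⟨letter a x, subset_rfl, fun _ _ _ => Iff.rfl⟩

/-- Back-and-forth equivalence of positions is of finite index, with definable classes. -/
theorem finitelySeparated_backForth [Finite A] (n : ℕ) :
    FinitelySeparated {x : List A × ℕ | x.2 < x.1.length} (pointedDefinable A)
      (fun x y => BackForth n x.1 x.2 y.1 y.2) := by
  have hletter : FinitelySeparated {x : List A × ℕ | x.2 < x.1.length} (pointedDefinable A)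
      (fun x y => x.1[x.2]? = y.1[y.2]?) := by
    refine (FinitelySeparated.forall fun a : A =>
      finitelySeparated_of_mem (letter_mem_pointedDefinable a)).mono fun x hx y _ h => ?_
    have hx' := List.getElem?_eq_getElem hx
    exact hx'.trans ((h _).1 hx').symm
  induction n with
  | zero => exact hletter
  | succ n ih =>
    obtain ⟨S, hS, hSD, hSE⟩ := ih
    have hcell := isBooleanOn_pointedDefinable.cell_mem hS hSD
    have hfin : Finite (𝒫 S) := hS.finite_subsets.to_subtype
    -- The subsets of `S` index finitely many cells, each within one class of depth `n`. For depth
    -- `n + 1` it is enough to know the letter, the cell of the position, and which cells occur to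
    -- its left and to its right.
    have hlt := FinitelySeparated.forall (W := {x : List A × ℕ | x.2 < x.1.length})
      fun R : 𝒫 S => finitelySeparated_of_mem (exists_lt_mem_pointedDefinable (hcell R.1))
    have hgt := FinitelySeparated.forall (W := {x : List A × ℕ | x.2 < x.1.length})
      fun R : 𝒫 S => finitelySeparated_of_mem (exists_gt_mem_pointedDefinable (hcell R.1))
    have heq := FinitelySeparated.forall (W := {x : List A × ℕ | x.2 < x.1.length})
      fun R : 𝒫 S => finitelySeparated_of_mem (hcell R.1)
    refine (hletter.and (hlt.and (hgt.and heq))).mono ?_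
    have forth : ∀ u p v q, p < u.length → q < v.length →
        (∀ R : 𝒫 S, (u, p) ∈ {x : List A × ℕ | ∃ q < x.1.length, q < x.2 ∧ (x.1, q) ∈ cell S R.1} ↔
          (v, q) ∈ {x : List A × ℕ | ∃ q < x.1.length, q < x.2 ∧ (x.1, q) ∈ cell S R.1}) →
        (∀ R : 𝒫 S, (u, p) ∈ {x : List A × ℕ | ∃ q < x.1.length, x.2 < q ∧ (x.1, q) ∈ cell S R.1} ↔
          (v, q) ∈ {x : List A × ℕ | ∃ q < x.1.length, x.2 < q ∧ (x.1, q) ∈ cell S R.1}) →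
        (∀ R : 𝒫 S, (u, p) ∈ cell S R.1 ↔ (v, q) ∈ cell S R.1) →
        ∀ p' < u.length, ∃ q' < v.length, SameSide p p' q q' ∧ BackForth n u p' v q' := by
      intro u p v q hp hq h1 h2 h3 p' hp'
      have hself := mem_cell_self S (u, p')
      have hR : {M ∈ S | (u, p') ∈ M} ∈ 𝒫 S := fun M hM => hM.1
      unfold SameSide
      rcases lt_trichotomy p' p with hlt | rfl | hlt
      · obtain ⟨q', hq', hq'q, hc⟩ := (h1 ⟨_, hR⟩).1 ⟨p', hp', hlt, hself⟩
        exact ⟨q', hq', by dsimp only at hq'q; omega,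
          hSE _ hp' (v, q') hq' (mem_iff_of_mem_cell hself hc)⟩
      · exact ⟨q, hq, by omega,
          hSE _ hp' (v, q) hq (mem_iff_of_mem_cell hself ((h3 ⟨_, hR⟩).1 hself))⟩
      · obtain ⟨q', hq', hq'q, hc⟩ := (h2 ⟨_, hR⟩).1 ⟨p', hp', hlt, hself⟩
        exact ⟨q', hq', by dsimp only at hq'q; omega,
          hSE _ hp' (v, q') hq' (mem_iff_of_mem_cell hself hc)⟩
    rintro ⟨u, p⟩ hp ⟨v, q⟩ hq ⟨h0, h1, h2, h3⟩
    refine ⟨h0, forth u p v q hp hq h1 h2 h3, fun q' hq' => ?_⟩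
    obtain ⟨p', hp', hs, hb⟩ := forth v q u p hq hp (fun R => (h1 R).symm) (fun R => (h2 R).symm)
      (fun R => (h3 R).symm) q' hq'
    exact ⟨p', hp', hs.symm, hb.symm⟩

theorem exists_mem_definable {M : Set (List A × ℕ)} (hM : M ∈ pointedDefinable A) :
    {w : List A | ∃ q < w.length, (w, q) ∈ M} ∈ {L : Set (List A) | FO2Definable L} := by
  obtain ⟨φ, hφ, h⟩ := hM 0
  refine ⟨ex 0 φ, ?_, ?_⟩
  · refine Finset.eq_empty_of_forall_notMem fun y hy => ?_
    simp only [freeVars, Finset.mem_erase] at hy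
    exact hy.1 (Finset.mem_singleton.1 (hφ hy.2))
  · ext w
    refine exists_congr fun q => and_congr_right fun hq => ?_
    rw [h _ _ (by simpa), Function.update_self]

/-- Back-and-forth equivalence of words is of finite index, with definable classes. -/
theorem finitelySeparated_wordEquiv [Finite A] (n : ℕ) :
    FinitelySeparated Set.univ {L : Set (List A) | FO2Definable L} (WordEquiv n) := by
  obtain ⟨S, hS, hSD, hSE⟩ := finitelySeparated_backForth (A := A) n
  have hcell := isBooleanOn_pointedDefinable.cell_mem hS hSD
  have hfin : Finite (𝒫 S) := hS.finite_subsets.to_subtype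
  refine (FinitelySeparated.forall fun R : 𝒫 S =>
    finitelySeparated_of_mem (exists_mem_definable (hcell R.1))).mono ?_
  have forth : ∀ u v : List A, (∀ R : 𝒫 S, u ∈ {w : List A | ∃ q < w.length, (w, q) ∈ cell S R.1} ↔
      v ∈ {w : List A | ∃ q < w.length, (w, q) ∈ cell S R.1}) →
      ∀ p < u.length, ∃ q < v.length, BackForth n u p v q := by
    intro u v h p hp
    have hself := mem_cell_self S (u, p)
    have hR : {M ∈ S | (u, p) ∈ M} ∈ 𝒫 S := fun M hM => hM.1
    obtain ⟨q, hq, hc⟩ := (h ⟨_, hR⟩).1 ⟨p, hp, hself⟩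
    exact ⟨q, hq, hSE _ hp (v, q) hq (mem_iff_of_mem_cell hself hc)⟩
  intro u _ v _ h
  refine ⟨forth u v h, fun q hq => ?_⟩
  obtain ⟨p, hp, hb⟩ := forth v u (fun R => (h R).symm) q hq
  exact ⟨p, hp, hb.symm⟩

theorem reverse_preimage_mem_levelOver {B : Finset A} {k : ℕ} {M : Set (List A)}
    (hM : M ∈ levelOver B k) : List.reverse ⁻¹' M ∈ levelOver B k := by
  obtain ⟨φ, hφ, hk, h⟩ := hM
  refine ⟨φ.flip, (freeVars_flip φ).trans hφ, (blocksFrom_flip φ _ _).trans_le hk, fun w hw => ?_⟩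
  rw [sat_flip w φ _ (fun _ => 0) fun x hx => by rw [hφ] at hx; simp at hx]
  exact h _ fun a ha => hw a (List.mem_reverse.1 ha)

/-- An existential sentence says this, and the quantifiers of `beyond` join its leading block. -/
theorem mem_drop_cut_mem_levelOver (B : Finset A) (k : ℕ) (s : List A) (c : A) :
    {w : List A | c ∈ w.drop (cut s w)} ∈ levelOver B (k + 1) := by
  refine ⟨ex 0 (and (letter c 0) (beyond s 0)), ?_, ?_, fun w _ => ?_⟩
  · refine Finset.eq_empty_of_forall_notMem fun y hy => ?_
    simp only [freeVars, Finset.mem_erase, Finset.mem_union] at hy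
    rcases hy with ⟨hy, hy' | hy'⟩
    · exact hy (Finset.mem_singleton.1 hy')
    · exact hy (Finset.mem_singleton.1 (freeVars_beyond s 0 hy'))
  · simp [blocks, blocksFrom, blocksFrom_beyond_self]
  · simp only [Sat, Function.update_self, Set.mem_ofPred_eq]
    rw [List.mem_iff_getElem?]
    simp only [List.getElem?_drop]
    constructor
    · rintro ⟨i, hi, hc, hb⟩
      rw [sat_beyond _ _ _ _ (by simpa using hi.le), Function.update_self] at hb
      obtain ⟨j, rfl⟩ := Nat.exists_eq_add_of_le hb
      exact ⟨j, hc⟩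
    · rintro ⟨j, hc⟩
      have hi := (List.getElem?_eq_some_iff.1 hc).1
      refine ⟨_, hi, hc, ?_⟩
      rw [sat_beyond _ _ _ _ (by simpa using hi.le), Function.update_self]
      omega

open Classical in
/-- A property of the factor between the greedy occurrence of `s.reverse` and the next `c` costs
one more block than the same property of words without the letter `c`. -/
theorem gap_preimage_mem_levelOver {B : Finset A} {k : ℕ} {M : Set (List A)} (s : List A) (c : A)
    (hM : M ∈ levelOver (B.erase c) k) :
    {w : List A | (w.drop (cut s w)).take ((w.drop (cut s w)).idxOf c) ∈ M} ∈
      levelOver B (k + 1) := by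
  obtain ⟨φ, hφ, hk, h⟩ := hM
  have hfree : ∀ x, (inGap s c x).freeVars ⊆ {x} := fun x =>
    Finset.union_subset (freeVars_beyond _ _)
      (Finset.union_subset subset_rfl (freeVars_beyond _ _))
  have hrel : (φ.relativize (inGap s c)).IsSentence :=
    Finset.subset_empty.1 ((freeVars_relativize hfree φ).trans hφ.le)
  refine ⟨φ.relativize (inGap s c), hrel, ?_, fun w hw => ?_⟩
  · refine (blocksFrom_relativize (fun x pos cur => ?_) φ _ _).trans (Nat.succ_le_succ hk)
    exact max_le (blocksFrom_beyond _ _ _ _)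
      (max_le (Nat.zero_le _) (blocksFrom_beyond _ _ _ _))
  -- The assignment is moved to the start of the gap, where it is the shift of the zero assignment
  -- on the factor.
  · rw [hrel.sat_iff w _ (fun _ => cut s w + 0),
      sat_relativize (fun x v hv => sat_inGap w s c x v hv) φ (fun _ => 0)
        fun x hx => by rw [hφ] at hx; simp at hx]
    -- The factor ends before the first `c`, so it is a word over the smaller alphabet.
    refine h _ fun a ha => Finset.mem_erase.2
      ⟨?_, hw a (List.mem_of_mem_drop (List.mem_of_mem_take ha))⟩
    rintro rfl
    rw [List.mem_take_iff_getElem] at ha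
    obtain ⟨i, hi, ha⟩ := ha
    exact absurd (List.not_of_lt_findIdx (p := (· == a))
      (show i < (w.drop (cut s w)).idxOf a by omega)) (by simp [ha])

open Classical in
/-- The greedy equivalence over `B` is of finite index, with classes that need one block more than
definable sets over smaller alphabets do. -/
theorem finitelySeparated_greedyEquiv [Finite A] {B : Finset A} {k : ℕ}
    (h : ∀ c ∈ B, ∀ L : Language A, FO2Definable L → L ∈ levelOver (B.erase c) k) (n N : ℕ)
    (s : List A) :
    FinitelySeparated (wordsOver B) (levelOver B (k + 1))
      (fun u v => GreedyEquiv B n N (u.drop (cut s u)) (v.drop (cut s v))) := by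
  induction N generalizing s with
  | zero => exact ⟨∅, Set.finite_empty, by simp, fun _ _ _ _ _ => trivial⟩
  | succ N ih =>
    refine (FinitelySeparated.forall fun c : {c // c ∈ B} =>
      (finitelySeparated_of_mem (mem_drop_cut_mem_levelOver B k s c.1)).and
        (((finitelySeparated_wordEquiv n).comap
          (fun w => (w.drop (cut s w)).take ((w.drop (cut s w)).idxOf c.1))
          (fun _ _ => Set.mem_univ _)
          (fun M hM => gap_preimage_mem_levelOver s c.1 (h c.1 c.2 M hM))).and
        -- The cut of `c :: s` lies just behind the next `c`, where the remaining `N` steps begin.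
        (ih (c.1 :: s)))).mono ?_
    intro u _ v _ huv c hc
    obtain ⟨h1, h2, h3⟩ := huv ⟨c, hc⟩
    refine ⟨h1, h2, ?_⟩
    rw [List.drop_drop, List.drop_drop]
    exact h3

/-- Over `k` letters, `k` quantifier blocks suffice. -/
theorem FO2Definable.mem_levelOver [Finite A] {L : Language A} (hL : FO2Definable L)
    (B : Finset A) : L ∈ levelOver B B.card := by
  classical
  generalize hk : B.card = k
  induction k generalizing B L with
  | zero =>
    rw [Finset.card_eq_zero] at hk
    subst hk
    have hnil : ∀ w ∈ wordsOver (∅ : Finset A), w = [] := fun w hw =>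
      List.eq_nil_iff_forall_not_mem.2 fun a ha => absurd (hw a ha) (by simp)
    by_cases h : ([] : List A) ∈ L
    · exact ⟨neg falsum, rfl, le_rfl, fun w hw => by rw [hnil w hw]; exact iff_of_true id h⟩
    · exact ⟨falsum, rfl, le_rfl, fun w hw => by rw [hnil w hw]; exact iff_of_false id h⟩
  | succ k ih =>
    obtain ⟨φ, hφ, rfl⟩ := hL
    have hsep := finitelySeparated_greedyEquiv (B := B) (k := k)
      (fun c hc L hL => ih hL _ (by rw [Finset.card_erase_of_mem hc, hk, Nat.add_sub_cancel]))
      φ.depth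
    -- Levels are invariant under reversal, so the factorizations from the right cost no additional
    -- block.
    have hrev := (hsep (φ.depth + 1) []).comap (V := wordsOver B) List.reverse
      (fun w hw a ha => hw a (List.mem_reverse.1 ha)) fun M => reverse_preimage_mem_levelOver
    refine ((hsep (φ.depth + 1 + (φ.depth + 1)) []).and hrev).mem_of_saturated
      (isBooleanOn_levelOver B (k + 1)) _ fun u hu v hv huv => ?_
    exact hφ.sat_of_wordEquiv (GreedyEquiv.wordEquiv hu hv huv.1 huv.2)

end Definability

theorem mainTheorem6 {A : Type*} [Fintype A] (k : ℕ) (hk : Fintype.card A = k) :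
    (∀ L : Language A, FO2Definable L →
      ∃ φ : FO2Formula A, φ.IsSentence ∧ φ.blocks = k ∧ φ.language = L) ∧
    (∀ m : ℕ, k ≤ m → FO2Level A m = FO2Level A k) := by
  have main : ∀ L : Language A, FO2Definable L →
      ∃ φ : FO2Formula A, φ.IsSentence ∧ φ.blocks = k ∧ φ.language = L := by
    intro L hL
    obtain ⟨φ, hφ, hb, h⟩ := hL.mem_levelOver Finset.univ
    rw [Finset.card_univ, hk] at hb
    obtain ⟨ψ, hψ, hψb, hψl⟩ := hφ.exists_blocks_eq hb
    refine ⟨ψ, hψ, hψb, hψl.trans ?_⟩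
    ext w
    exact h w fun a _ => Finset.mem_univ a
  refine ⟨main, fun m hm => Set.Subset.antisymm ?_ ?_⟩
  · rintro L ⟨φ, hφ, -, hL⟩
    obtain ⟨ψ, hψ, hψb, hψl⟩ := main L ⟨φ, hφ, hL⟩
    exact ⟨ψ, hψ, hψb.le, hψl⟩
  · rintro L ⟨φ, hφ, hb, hL⟩
    exact ⟨φ, hφ, hb.trans hm, hL⟩
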